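/- **Model.** Fix a horizon $T\ge 1$. In round $t=1,\dots,T$ a maker plays a bid $B$ and an ask $A$ in $[0,1]$, then a taker with valuation $V_t$ arrives and the market price $M_t$ is revealed. With bid $b$, ask $a$, valuation $v$ and price $m$ the reward is $r(b,a;v,m)=\mathbb 1(v\le b)(m-b)+\mathbb 1(a\le v)(a-m)$. The valuations $V_1,\dots,V_T$ are i.i.d. with values in $[0,1]$, law $\nu$ and c.d.f. $F$; $S:=1-F$. The prices $M_t\in[0,1]$ are adapted to a filtration $(\mathcal F_t)$ (no relation between the $V$'s and the $M$'s is assumed). Order-book feedback: if $V_t$ lies between the quotes it is revealed, otherwise only the side of the trade is; the valuation enters the algorithm only through the clipped value $V^{\rm clip}$ below. If $(B_t,A_t)$ denotes the pair played in round $t$, the regret is $$R_T=\sup_{b,a\in[0,1]}\sum_{t=1}^T\mathbb E_{v\sim\nu}\big[r(b,a;v,M_t)-r(B_t,A_t;v,M_t)\big],$$ and its variant is $R'_T=\sup_{b,a\in[0,1]}\sum_{t=1}^T \big(J_t(b,a)-J_t(B_t,A_t)\big)$, $J_t(b,a)=F(b)(M_t-b)+S(a)(a-M_t)$; the two coincide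 if $F$ is continuous. **Mean reversion.** *Local:* there are $k$ weights $\gamma_0,\dots,\gamma_{k-1}\ge 0$ with $\gamma:=\sum_\tau\gamma_\tau<1$, a constant $\mu$, $\mathcal F_0$-measurable initial values $M_t\in[0,1]$ ($-k<t\le 0$) and noise $\eta_t\in[0,1]$ with $\mathbb E[\eta_{t+1}\mid\mathcal F_t]=\mu$ such that $M_{t+1}=\sum_{\tau=0}^{k-1}\gamma_\tau M_{t-\tau}+(1-\gamma)\eta_{t+1}$ for $0\le t<T$. *Global:* there is a constant $\mu$ with $\mathbb E[M_{t+1}-\mu\mid\mathcal F_t]\cdot\sum_{s=1}^t(M_s-\mu)\le 0$ a.s. for $1\le t<T$. **Algorithm LazyOPSR** with horizon $T$, confidence parameter $\delta'$ and radius $\varphi$. Let $\mathcal A=\{n/\lceil\sqrt T\rceil:0\le n\le\lceil\sqrt T\rceil\}$ and $\psi(t)=\sqrt{3\log(3T/\delta')/(4t)}$. Start with $(b_0,a_0)=(0,1)$, $F_0^{\rm up}=1$, $F_0^{\rm low}=0$, $\mu_0^{\rm up}=1$, $\mu_0^{\rm low}=0$. In round $t\ge1$ play $(B_t,A_t)=(b_{t-1},a_{t-1})$.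 Let $V_t^{\rm clip}$ be $B_t$ if $V_t<B_t$, $V_t$ if $B_t\le V_t\le A_t$, and $A_t+0.01$ if $V_t>A_t$. Put $\widehat F_t(x)=\frac1t\#\{s\le t:V_s^{\rm clip}\le x\}$, $\widehat\mu_t=\frac1t\sum_{s\le t}M_s$ and update $$F_t^{\rm up}=\min\{F_{t-1}^{\rm up},\widehat F_t+\psi(t)\},\quad F_t^{\rm low}=\max\{F_{t-1}^{\rm low},\widehat F_t-\psi(t)\},$$ $$\mu_t^{\rm up}=\min\{\mu_{t-1}^{\rm up},\widehat\mu_t+\varphi(t)\},\quad \mu_t^{\rm low}=\max\{\mu_{t-1}^{\rm low},\widehat\mu_t-\varphi(t)\}.$$ If $t$ is not a power of two, $(b_t,a_t)=(b_{t-1},a_{t-1})$. If $t=2^p$ for some integer $p\ge 0$, let $\mathcal A_{t-1}=\mathcal A\cap[b_{t-1},a_{t-1}]$, let $b_t$ be the smallest $x\in\mathcal A_{t-1}$ with $(\mu_t^{\rm low}-x)F_t^{\rm up}(x)\ge\max_{y\in\mathcal A_{t-1}}(\mu_t^{\rm low}-y)F_t^{\rm low}(y)$, and let $a_t$ be the largest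 $x\in\mathcal A_{t-1}$ with $(x-\mu_t^{\rm up})(1-F_t^{\rm low}(x))\ge\max_{y\in\mathcal A_{t-1}}(y-\mu_t^{\rm up})(1-F_t^{\rm up}(y))$ (a quote for which no such $x$ exists is left unchanged). **Theorem.** There is an absolute constant $C$ such that, for all $T\ge1$, all $\delta\in(0,1)$ and all environments as above, the following holds with $\delta'=\delta/2$. 1. Under local mean reversion, LazyOPSR with $\varphi(t)=\sqrt{\frac{\log(2T/\delta')}{2t}}+\frac{\gamma(k+1)}{(1-\gamma)t}$ satisfies, with probability at least $1-\delta$, $$\max\{R_T,R'_T\}\le\sqrt{2007\,T\log(6T/\delta)}+\frac{8\gamma(k+1)\log T}{1-\gamma}+C\sqrt T .$$ 2. Under global mean reversion, LazyOPSR with $\varphi(t)=\sqrt{\frac{4\log(2T/\delta')}{t}}$ satisfies, with probability at least $1-\delta$, $$\max\{R_T,R'_T\}\le\sqrt{20783\,T\log(6T/\delta)}+C\sqrt T .$$ -/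

import Mathlib

open MeasureTheory ProbabilityTheory

universe u

noncomputable section

/-- Reward of the maker when it quotes bid `b` and ask `a`, the taker has valuation `v`
and the market price is `m`. -/
def reward (b a v m : ℝ) : ℝ :=
  (if v ≤ b then m - b else 0) + (if a ≤ v then a - m else 0)

/-- `F(b) (m - b) + S(a) (a - m)`, where `F` is the c.d.f. of the valuation law `ν` and
`S = 1 - F`. -/
def objective (ν : Measure ℝ) (b a m : ℝ) : ℝ :=
  cdf ν b * (m - b) + (1 - cdf ν a) * (a - m)

/-- Regret over rounds `1, …, T` of the quotes `q t = (bid, ask)` played in round `t`, along the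
price path `m`: supremum over fixed quotes in `[0,1]²` of the difference of the rewards,
averaged over the valuations. -/
def regret (ν : Measure ℝ) (T : ℕ) (q : ℕ → ℝ × ℝ) (m : ℕ → ℝ) : ℝ :=
  ⨆ p : Set.Icc (0 : ℝ) 1 × Set.Icc (0 : ℝ) 1, ∑ t ∈ Finset.Icc 1 T,
    ∫ v, (reward p.1 p.2 v (m t) - reward (q t).1 (q t).2 v (m t)) ∂ν

/-- The same regret written through `objective`; it equals `regret` when `ν` has no atom. -/
def objectiveRegret (ν : Measure ℝ) (T : ℕ) (q : ℕ → ℝ × ℝ) (m : ℕ → ℝ) : ℝ :=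
  ⨆ p : Set.Icc (0 : ℝ) 1 × Set.Icc (0 : ℝ) 1, ∑ t ∈ Finset.Icc 1 T,
    (objective ν p.1 p.2 (m t) - objective ν (q t).1 (q t).2 (m t))

/-! ### The algorithm -/

/-- The uniform grid `{n / ⌈√T⌉ : n = 0, …, ⌈√T⌉}`. -/
def priceGrid (T : ℕ) : Finset ℝ :=
  (Finset.range (⌈√(T : ℝ)⌉₊ + 1)).image fun n : ℕ => (n : ℝ) / (⌈√(T : ℝ)⌉₊ : ℝ)

/-- The valuation as it enters the algorithm when the quotes `(b, a)` are played. -/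
def clippedValuation (b a v : ℝ) : ℝ :=
  if v < b then b else if v ≤ a then v else a + 0.01

/-- Confidence radius for the empirical c.d.f. after `t` rounds. -/
def cdfRadius (T : ℕ) (δ : ℝ) (t : ℕ) : ℝ :=
  √(3 * Real.log (3 * T / δ) / (4 * t))

/-- Confidence radius for the empirical mean price under local mean reversion with `k` lags
and total weight `γ`. -/
def localRadius (T : ℕ) (δ γ : ℝ) (k t : ℕ) : ℝ :=
  √(Real.log (2 * T / δ) / (2 * t)) + γ * (k + 1) / ((1 - γ) * t)

/-- Confidence radius for the empirical mean price under global mean reversion. -/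
def globalRadius (T : ℕ) (δ : ℝ) (t : ℕ) : ℝ :=
  √(4 * Real.log (2 * T / δ) / t)

/-- Memory of the algorithm at the end of a round. -/
structure OPSRState where
  /-- bid for the next round -/
  bid : ℝ
  /-- ask for the next round -/
  ask : ℝ
  /-- number of rounds so far whose clipped valuation is at most `x` -/
  hits : ℝ → ℝ
  /-- sum of the market prices so far -/
  priceSum : ℝ
  /-- upper confidence bound for the c.d.f. -/
  cdfUp : ℝ → ℝ
  /-- lower confidence bound for the c.d.f. -/
  cdfLow : ℝ → ℝ
  /-- upper confidence bound for the mean price -/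
  meanUp : ℝ
  /-- lower confidence bound for the mean price -/
  meanLow : ℝ

namespace OPSRState

/-- The memory before the first round. -/
def start : OPSRState where
  bid := 0
  ask := 1
  hits := fun _ => 0
  priceSum := 0
  cdfUp := fun _ => 1
  cdfLow := fun _ => 0
  meanUp := 1
  meanLow := 0

/-- Update of the estimators at the end of round `t`, in which the quotes stored in `s` were
played, `v` is the valuation and `m` the market price; `φ` is the radius for the mean price.
The valuation is used only through its clipped value. -/
def observe (T : ℕ) (δ : ℝ) (φ : ℕ → ℝ) (t : ℕ) (s : OPSRState) (v m : ℝ) : OPSRState :=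
  let hits : ℝ → ℝ := fun x =>
    s.hits x + if clippedValuation s.bid s.ask v ≤ x then 1 else 0
  let priceSum : ℝ := s.priceSum + m
  { bid := s.bid
    ask := s.ask
    hits := hits
    priceSum := priceSum
    cdfUp := fun x => min (s.cdfUp x) (hits x / t + cdfRadius T δ t)
    cdfLow := fun x => max (s.cdfLow x) (hits x / t - cdfRadius T δ t)
    meanUp := min s.meanUp (priceSum / t + φ t)
    meanLow := max s.meanLow (priceSum / t - φ t) }

/-- Grid prices that lie between the current quotes. -/
def active (T : ℕ) (s : OPSRState) : Finset ℝ :=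
  (priceGrid T).filter fun x => s.bid ≤ x ∧ x ≤ s.ask

/-- Optimistic value of the bid `x`. -/
def thetaBid (s : OPSRState) (x : ℝ) : ℝ := (s.meanLow - x) * s.cdfUp x

/-- Optimistic value of the ask `x`. -/
def thetaAsk (s : OPSRState) (x : ℝ) : ℝ := (x - s.meanUp) * (1 - s.cdfLow x)

/-- Pessimistic value of the bid `x`. -/
def gammaBid (s : OPSRState) (x : ℝ) : ℝ := (s.meanLow - x) * s.cdfLow x

/-- Pessimistic value of the ask `x`. -/
def gammaAsk (s : OPSRState) (x : ℝ) : ℝ := (x - s.meanUp) * (1 - s.cdfUp x)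

/-- Active prices whose optimistic bid value is at least the largest pessimistic bid value. -/
def bidCandidates (T : ℕ) (s : OPSRState) : Finset ℝ :=
  (s.active T).filter fun x => sSup (s.gammaBid '' (s.active T : Set ℝ)) ≤ s.thetaBid x

/-- Active prices whose optimistic ask value is at least the largest pessimistic ask value. -/
def askCandidates (T : ℕ) (s : OPSRState) : Finset ℝ :=
  (s.active T).filter fun x => sSup (s.gammaAsk '' (s.active T : Set ℝ)) ≤ s.thetaAsk x

/-- The elimination step: the new bid is the smallest candidate bid, the new ask the largest
candidate ask. A quote is kept if there is no candidate for it. -/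
def eliminate (T : ℕ) (s : OPSRState) : OPSRState :=
  { s with
    bid := if h : (s.bidCandidates T).Nonempty then (s.bidCandidates T).min' h else s.bid
    ask := if h : (s.askCandidates T).Nonempty then (s.askCandidates T).max' h else s.ask }

end OPSRState

open Classical in
/-- Memory of LazyOPSR at the end of round `t`, with horizon `T`, confidence parameter `δ` and
mean-price radius `φ`, on the valuations `v 1, v 2, …` and the prices `m 1, m 2, …`.
Eliminations take place only in rounds that are powers of two. -/
def lazyOPSR (T : ℕ) (δ : ℝ) (φ : ℕ → ℝ) (v m : ℕ → ℝ) : ℕ → OPSRState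
  | 0 => OPSRState.start
  | t + 1 =>
    let s := (lazyOPSR T δ φ v m t).observe T δ φ (t + 1) (v (t + 1)) (m (t + 1))
    if ∃ p : ℕ, t + 1 = 2 ^ p then s.eliminate T else s

/-- Quotes `(bid, ask)` that LazyOPSR plays in round `t ≥ 1`: those fixed at the end of round
`t - 1`. -/
def lazyQuotes (T : ℕ) (δ : ℝ) (φ : ℕ → ℝ) (v m : ℕ → ℝ) (t : ℕ) : ℝ × ℝ :=
  ((lazyOPSR T δ φ v m (t - 1)).bid, (lazyOPSR T δ φ v m (t - 1)).ask)

/-- The larger of the two forms of the regret of LazyOPSR over the horizon `T`. -/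
def lazyRegret (ν : Measure ℝ) (T : ℕ) (δ : ℝ) (φ : ℕ → ℝ) (v m : ℕ → ℝ) : ℝ :=
  max (regret ν T (lazyQuotes T δ φ v m) m) (objectiveRegret ν T (lazyQuotes T δ φ v m) m)

/-! ### The environment -/

section Environment

variable {Ω : Type u} [mΩ : MeasurableSpace Ω]

/-- The valuations of rounds `1, …, T` are independent with common law `ν`, in `[0,1]`. -/
structure StochasticValuations (P : Measure Ω) (ν : Measure ℝ) (T : ℕ) (V : ℕ → Ω → ℝ) :
    Prop where
  measurable : ∀ t ∈ Set.Icc 1 T, Measurable (V t)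
  law : ∀ t ∈ Set.Icc 1 T, P.map (V t) = ν
  indep : iIndepFun (fun t : Set.Icc 1 T => V t) P
  mem_Icc : ∀ t ∈ Set.Icc 1 T, ∀ᵐ ω ∂P, V t ω ∈ Set.Icc (0 : ℝ) 1

/-- The market prices of rounds `1, …, T` are in `[0,1]` and adapted to `ℱ`. -/
structure BoundedPrices (P : Measure Ω) (ℱ : Filtration ℕ mΩ) (T : ℕ) (M : ℕ → Ω → ℝ) :
    Prop where
  adapted : ∀ t ∈ Set.Icc 1 T, StronglyMeasurable[ℱ t] (M t)
  mem_Icc : ∀ t ∈ Set.Icc 1 T, ∀ᵐ ω ∂P, M t ω ∈ Set.Icc (0 : ℝ) 1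

/-- Local mean reversion: from arbitrary initial conditions `M t`, `-k < t ≤ 0`, in `[0,1]` the
prices follow an autoregression with weights `g 0, …, g (k - 1)` and noise `η`, where `η` has
values in `[0,1]` and constant conditional mean `μ`. -/
structure LocalMeanReversion (P : Measure Ω) (ℱ : Filtration ℕ mΩ) (T k : ℕ) (g : Fin k → ℝ)
    (μ : ℝ) (η : ℕ → Ω → ℝ) (M : ℤ → Ω → ℝ) : Prop where
  weight_nonneg : ∀ τ, 0 ≤ g τ
  weight_sum_lt_one : ∑ τ, g τ < 1
  initial_measurable : ∀ t : ℤ, -(k : ℤ) < t → t ≤ 0 → StronglyMeasurable[ℱ 0] (M t)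
  initial_mem_Icc : ∀ t : ℤ, -(k : ℤ) < t → t ≤ 0 → ∀ᵐ ω ∂P, M t ω ∈ Set.Icc (0 : ℝ) 1
  recursion : ∀ t : ℕ, t < T → ∀ᵐ ω ∂P,
    M ((t : ℤ) + 1) ω =
      ∑ τ : Fin k, g τ * M ((t : ℤ) - (τ : ℕ)) ω + (1 - ∑ τ, g τ) * η (t + 1) ω
  noise_mem_Icc : ∀ t : ℕ, t < T → ∀ᵐ ω ∂P, η (t + 1) ω ∈ Set.Icc (0 : ℝ) 1
  noise_mean : ∀ t : ℕ, t < T → P[η (t + 1) | ℱ t] =ᵐ[P] fun _ => μ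

/-- Global mean reversion: the conditional expectation of the next deviation `M (t + 1) - μ`
never has the sign of the cumulative deviation up to time `t`. -/
def GlobalMeanReversion (P : Measure Ω) (ℱ : Filtration ℕ mΩ) (T : ℕ) (μ : ℝ)
    (M : ℕ → Ω → ℝ) : Prop :=
  ∀ t : ℕ, 1 ≤ t → t < T → ∀ᵐ ω ∂P,
    (P[fun ω' => M (t + 1) ω' - μ | ℱ t]) ω * ∑ s ∈ Finset.Icc 1 t, (M s ω - μ) ≤ 0

end Environment

end

noncomputable section

/-! ### The elimination step -/

section Elimination

variable {A : Finset ℝ} {r lo G up : ℝ → ℝ} {l μ b : ℝ}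

/-! On a good path, where every empirical c.d.f. and mean price stays within its radius, the regret
bound is deterministic. The expected reward is affine in the price, so the regret splits into the
regret at the constant price `μ` and sums of the deviations `m t - μ`, weighted by the slope of the
benchmark, by `F` of the bid and by `Q` of the ask. Since bids only increase and asks only decrease,
the last two weights are monotone, and summation by parts bounds all three sums by the largest
partial sum of deviations, hence by `t * φ t` (`GoodPath.sum_le`).

At price `μ` the two quotes decouple. Elimination never discards an optimal grid quote
(`first_candidate_le_maximizer`) and leaves quotes whose loss is of the order of the radii
(`candidate_gap`); the ask side is the bid side under `x ↦ -x`. Nested quotes also make the censored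
feedback sufficient: clipping does not affect the event `v ≤ x` for a price `x` between the quotes.
The invariant `Confident` carries these facts through the rounds. Acting only at powers of two means
paying the radius of the last one, which costs constant factors in the sums over dyadic epochs.

A path is good with probability at least `1 - δ`, half of `δ` going to each estimator. The c.d.f.
needs Hoeffding and a union bound over rounds and grid. Under local mean reversion the price sums
equal noise sums up to bounded boundary terms, and the noise has constant conditional mean. Under
global mean reversion the drift opposes the sign of the cumulative deviation `S`, so the expectation
of `cosh (l * S)` grows by a factor of at most `cosh l` per round. -/

theorem exists_candidate_le (hb : b ∈ A) (hbl : r b ≤ l) (hlo : ∀ x ∈ A, 0 ≤ lo x)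
    (hloG : ∀ x ∈ A, lo x ≤ G x) (hGup : ∀ x ∈ A, G x ≤ up x) :
    ∃ x ∈ A, r x ≤ l ∧ ∀ y ∈ A, (l - r y) * lo y ≤ (l - r x) * up x := by
  obtain ⟨z, hz, hmax⟩ := A.exists_max_image (fun y => (l - r y) * lo y) ⟨b, hb⟩
  -- If the pessimistic maximizer `z` lies beyond `l`, the maximum is nonpositive and `b`, with its
  -- nonnegative optimistic value, passes the test. Otherwise `z` itself passes.
  rcases lt_or_ge l (r z) with h | h
  · have hz0 : (l - r z) * lo z ≤ 0 :=
      mul_nonpos_of_nonpos_of_nonneg (by linarith) (hlo z hz)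
    have hG : 0 ≤ (l - r b) * G b :=
      mul_nonneg (by linarith) ((hlo b hb).trans (hloG b hb))
    have hup : (l - r b) * G b ≤ (l - r b) * up b :=
      mul_le_mul_of_nonneg_left (hGup b hb) (by linarith)
    exact ⟨b, hb, hbl, fun y hy => by linarith [hmax y hy]⟩
  · have hG : (l - r z) * lo z ≤ (l - r z) * G z :=
      mul_le_mul_of_nonneg_left (hloG z hz) (by linarith)
    have hup : (l - r z) * G z ≤ (l - r z) * up z :=
      mul_le_mul_of_nonneg_left (hGup z hz) (by linarith)
    exact ⟨z, hz, h, fun y hy => by linarith [hmax y hy]⟩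

/-- A maximizer of the true value is never ranked below the first candidate. -/
theorem first_candidate_le_maximizer {e : ℝ} (hlμ : l ≤ μ) (hb : b ∈ A) (hbl : r b ≤ l)
    (hlo : ∀ x ∈ A, 0 ≤ lo x) (hloG : ∀ x ∈ A, lo x ≤ G x) (hGup : ∀ x ∈ A, G x ≤ up x)
    (hmono : ∀ x ∈ A, ∀ y ∈ A, r x ≤ r y → G x ≤ G y)
    (hfirst : ∀ x ∈ A, (∀ y ∈ A, (l - r y) * lo y ≤ (l - r x) * up x) → r e ≤ r x)
    {y : ℝ} (hy : y ∈ A)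
    (hmax : ∀ z ∈ A, r z ≤ μ → (μ - r z) * G z ≤ (μ - r y) * G y) : r e ≤ r y := by
  obtain ⟨z, hz, hzl, hcand⟩ := exists_candidate_le hb hbl hlo hloG hGup
  -- A maximizer `y` ranked before `e` fails the test, so the pessimistic maximizer `w` beats it at
  -- level `l`. Since `w` passes, it ranks after `y` and `G y ≤ G w`. Raising `l` to `μ` adds `(μ -
  -- l) * G`, which favours `w`, so `w` beats `y` at `μ` too.
  by_contra! hlt
  have hez := hfirst z hz hcand
  have hyl : r y ≤ l := by linarith
  obtain ⟨w, hw, hwmax⟩ := A.exists_max_image (fun y => (l - r y) * lo y) ⟨b, hb⟩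
  have hnot : ¬ ∀ x ∈ A, (l - r x) * lo x ≤ (l - r y) * up y := fun h => by
    linarith [hfirst y hy h]
  push Not at hnot
  obtain ⟨x, hx, hxy⟩ := hnot
  have hwy : (l - r y) * up y < (l - r w) * lo w := hxy.trans_le (hwmax x hx)
  have hGy : 0 ≤ G y := (hlo y hy).trans (hloG y hy)
  have hyup : (l - r y) * G y ≤ (l - r y) * up y :=
    mul_le_mul_of_nonneg_left (hGup y hy) (by linarith)
  have hwl : r w ≤ l := by
    by_contra! h
    have h1 : (l - r w) * lo w ≤ 0 :=
      mul_nonpos_of_nonpos_of_nonneg (by linarith) (hlo w hw)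
    have h2 : 0 ≤ (l - r y) * G y := mul_nonneg (by linarith) hGy
    linarith
  have hwG : (l - r w) * lo w ≤ (l - r w) * G w :=
    mul_le_mul_of_nonneg_left (hloG w hw) (by linarith)
  have hwup : (l - r w) * G w ≤ (l - r w) * up w :=
    mul_le_mul_of_nonneg_left (hGup w hw) (by linarith)
  have hew := hfirst w hw fun x hx => by linarith [hwmax x hx]
  have hG := hmono y hy w hw (by linarith)
  have h1 := hmax w hw (by linarith)
  nlinarith [mul_nonneg (sub_nonneg.2 hlμ) (sub_nonneg.2 hG)]

/-- A candidate is nearly optimal for the true value. -/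
theorem candidate_gap {e w d : ℝ} (hlμ : l ≤ μ)
    (hloG : ∀ x ∈ A, lo x ≤ G x) (hlo : ∀ x ∈ A, 0 ≤ lo x) (hG1 : ∀ x ∈ A, G x ≤ 1)
    (hwlo : ∀ x ∈ A, G x - lo x ≤ w) (hwup : ∀ x ∈ A, up x - G x ≤ w) (hd : μ - l ≤ d)
    (hrange : ∀ x ∈ A, μ - r x ≤ 1) (he : e ∈ A) (hel : r e ≤ l)
    (hcand : ∀ y ∈ A, (l - r y) * lo y ≤ (l - r e) * up e)
    {y : ℝ} (hy : y ∈ A) :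
    (μ - r y) * G y ≤ (μ - r e) * G e + d + 2 * w := by
  have hGe : 0 ≤ G e := (hlo e he).trans (hloG e he)
  have hw0 : 0 ≤ w := (sub_nonneg.2 (hloG e he)).trans (hwlo e he)
  -- The c.d.f. error `w` is paid at both `e` and `y`, the mean error `d` only at `y`: replacing `μ`
  -- by `l` can only lower the value of `e`.
  have h1 : (l - r e) * (up e - G e) ≤ 1 * w := by
    calc (l - r e) * (up e - G e) ≤ (l - r e) * w :=
          mul_le_mul_of_nonneg_left (hwup e he) (by linarith)
      _ ≤ 1 * w := mul_le_mul_of_nonneg_right (by linarith [hrange e he]) hw0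
  have h2 : (μ - l) * G e ≥ 0 := mul_nonneg (by linarith) hGe
  have h3 : (μ - r y) * (G y - lo y) ≤ 1 * w :=
    mul_le_mul (hrange y hy) (hwlo y hy) (sub_nonneg.2 (hloG y hy)) zero_le_one
  have h4 : (μ - l) * lo y ≤ d * 1 :=
    mul_le_mul hd ((hloG y hy).trans (hG1 y hy)) (hlo y hy) (by linarith)
  have h5 := hcand y hy
  nlinarith

end Elimination

/-! ### Confidence along a price path -/

/-- Number of rounds up to `t` whose valuation is at most `x`. -/
def valuationCount (v : ℕ → ℝ) (t : ℕ) (x : ℝ) : ℝ :=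
  ∑ s ∈ Finset.Icc 1 t, if v s ≤ x then 1 else 0

/-- All empirical estimates up to the horizon lie within their confidence radii. -/
structure GoodPath (T : ℕ) (δ : ℝ) (φ : ℕ → ℝ) (v m : ℕ → ℝ) (F : ℝ → ℝ) (μ : ℝ) : Prop where
  mono : Monotone F
  nonneg : ∀ x, 0 ≤ F x
  le_one : ∀ x, F x ≤ 1
  mean_nonneg : 0 ≤ μ
  mean_le_one : μ ≤ 1
  cdf_close : ∀ t, 1 ≤ t → t ≤ T → ∀ x ∈ priceGrid T,
    |valuationCount v t x / t - F x| ≤ cdfRadius T δ t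
  mean_close : ∀ t, 1 ≤ t → t ≤ T → |(∑ s ∈ Finset.Icc 1 t, m s) / t - μ| ≤ φ t

theorem zero_mem_priceGrid (T : ℕ) : (0 : ℝ) ∈ priceGrid T :=
  Finset.mem_image.2 ⟨0, by simp, by simp⟩

theorem ceil_sqrt_pos {T : ℕ} (hT : 1 ≤ T) : 0 < ⌈√(T : ℝ)⌉₊ :=
  Nat.ceil_pos.2 (Real.sqrt_pos.2 (by exact_mod_cast hT))

theorem one_mem_priceGrid {T : ℕ} (hT : 1 ≤ T) : (1 : ℝ) ∈ priceGrid T :=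
  Finset.mem_image.2 ⟨⌈√(T : ℝ)⌉₊, by simp,
    div_self (by exact_mod_cast (ceil_sqrt_pos hT).ne')⟩

theorem mem_Icc_of_mem_priceGrid {T : ℕ} {x : ℝ} (hx : x ∈ priceGrid T) :
    x ∈ Set.Icc (0 : ℝ) 1 := by
  obtain ⟨n, hn, rfl⟩ := Finset.mem_image.1 hx
  refine ⟨by positivity, div_le_one_of_le₀ ?_ (by positivity)⟩
  exact_mod_cast Nat.lt_succ_iff.1 (Finset.mem_range.1 hn)

/-- This makes censored feedback as good as full feedback at the active prices. The offset `0.01`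
keeps a valuation above the ask from being counted at `x = a`. -/
theorem clippedValuation_le_iff {b a v x : ℝ} (hb : b ≤ x) (ha : x ≤ a) :
    clippedValuation b a v ≤ x ↔ v ≤ x := by
  unfold clippedValuation
  split_ifs with h1 h2
  · exact ⟨fun _ => by linarith, fun _ => hb⟩
  · rfl
  · exact ⟨fun h => by norm_num at h; linarith, fun h => by linarith⟩

/-- What the memory `s` guarantees at the end of round `t` of a good path. -/
structure Confident (T : ℕ) (v m : ℕ → ℝ) (F : ℝ → ℝ) (μ : ℝ) (t : ℕ) (s : OPSRState) :
    Prop where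
  bid_mem : s.bid ∈ priceGrid T
  ask_mem : s.ask ∈ priceGrid T
  low_le : s.meanLow ≤ μ
  le_up : μ ≤ s.meanUp
  bid_le : s.bid ≤ s.meanLow
  le_ask : s.meanUp ≤ s.ask
  hits_eq : ∀ x, s.bid ≤ x → x ≤ s.ask → s.hits x = valuationCount v t x
  priceSum_eq : s.priceSum = ∑ i ∈ Finset.Icc 1 t, m i
  cdfLow_nonneg : ∀ x, 0 ≤ s.cdfLow x
  cdfUp_le_one : ∀ x, s.cdfUp x ≤ 1
  cdfLow_le : ∀ x ∈ s.active T, s.cdfLow x ≤ F x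
  le_cdfUp : ∀ x ∈ s.active T, F x ≤ s.cdfUp x
  bid_le_opt : ∀ y ∈ priceGrid T, y ≤ μ →
    (∀ z ∈ priceGrid T, z ≤ μ → (μ - z) * F z ≤ (μ - y) * F y) → s.bid ≤ y
  opt_le_ask : ∀ y ∈ priceGrid T, μ ≤ y →
    (∀ z ∈ priceGrid T, μ ≤ z → (z - μ) * (1 - F z) ≤ (y - μ) * (1 - F y)) → y ≤ s.ask

/-- The confidence intervals in the memory `s` have half-widths at most `w` and `d`. -/
structure Narrow (T : ℕ) (F : ℝ → ℝ) (μ w d : ℝ) (s : OPSRState) : Prop where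
  low : μ - s.meanLow ≤ d
  up : s.meanUp - μ ≤ d
  cdfLow : ∀ x ∈ s.active T, F x - s.cdfLow x ≤ w
  cdfUp : ∀ x ∈ s.active T, s.cdfUp x - F x ≤ w

/-- The quotes in the memory `s` are within `ε` of the best grid quotes. -/
structure NearOptimal (T : ℕ) (F : ℝ → ℝ) (μ ε : ℝ) (s : OPSRState) : Prop where
  bid : ∀ y ∈ priceGrid T, y ≤ μ → (μ - y) * F y ≤ (μ - s.bid) * F s.bid + ε
  ask : ∀ y ∈ priceGrid T, μ ≤ y → (y - μ) * (1 - F y) ≤ (s.ask - μ) * (1 - F s.ask) + ε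

theorem OPSRState.mem_active {T : ℕ} {s : OPSRState} {x : ℝ} :
    x ∈ s.active T ↔ x ∈ priceGrid T ∧ s.bid ≤ x ∧ x ≤ s.ask := by
  simp [OPSRState.active]

theorem OPSRState.mem_bidCandidates {T : ℕ} {s : OPSRState} {x : ℝ} :
    x ∈ s.bidCandidates T ↔ x ∈ s.active T ∧ ∀ y ∈ s.active T, s.gammaBid y ≤ s.thetaBid x := by
  simp only [OPSRState.bidCandidates, Finset.mem_filter, and_congr_right_iff]
  intro hx
  rw [csSup_le_iff ((s.active T).finite_toSet.image _).bddAbove ⟨_, x, hx, rfl⟩]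
  simp

theorem OPSRState.mem_askCandidates {T : ℕ} {s : OPSRState} {x : ℝ} :
    x ∈ s.askCandidates T ↔ x ∈ s.active T ∧ ∀ y ∈ s.active T, s.gammaAsk y ≤ s.thetaAsk x := by
  simp only [OPSRState.askCandidates, Finset.mem_filter, and_congr_right_iff]
  intro hx
  rw [csSup_le_iff ((s.active T).finite_toSet.image _).bddAbove ⟨_, x, hx, rfl⟩]
  simp

/-! ### The confidence invariant along the algorithm -/

section Confident

variable {T : ℕ} {δ : ℝ} {φ : ℕ → ℝ} {v m : ℕ → ℝ} {F : ℝ → ℝ} {μ : ℝ} {t : ℕ} {s : OPSRState}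

theorem Confident.bid_mem_active (h : Confident T v m F μ t s) : s.bid ∈ s.active T :=
  OPSRState.mem_active.2
    ⟨h.bid_mem, le_rfl, by linarith [h.bid_le, h.low_le, h.le_up, h.le_ask]⟩

theorem Confident.ask_mem_active (h : Confident T v m F μ t s) : s.ask ∈ s.active T :=
  OPSRState.mem_active.2
    ⟨h.ask_mem, by linarith [h.bid_le, h.low_le, h.le_up, h.le_ask], le_rfl⟩

theorem GoodPath.confident_start (hT : 1 ≤ T) (h : GoodPath T δ φ v m F μ) :
    Confident T v m F μ 0 OPSRState.start where
  bid_mem := zero_mem_priceGrid T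
  ask_mem := one_mem_priceGrid hT
  low_le := h.mean_nonneg
  le_up := h.mean_le_one
  bid_le := le_rfl
  le_ask := le_rfl
  hits_eq := by simp [valuationCount, OPSRState.start]
  priceSum_eq := by simp [OPSRState.start]
  cdfLow_nonneg := fun _ => le_rfl
  cdfUp_le_one := fun _ => le_rfl
  cdfLow_le := fun x _ => h.nonneg x
  le_cdfUp := fun x _ => h.le_one x
  bid_le_opt := fun _ hy _ _ => (mem_Icc_of_mem_priceGrid hy).1
  opt_le_ask := fun _ hy _ _ => (mem_Icc_of_mem_priceGrid hy).2

/-- Running minima and maxima of valid bounds stay valid. The widths are twice the radii because the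
truth is within one radius of the empirical value, and so is each bound. -/
theorem Confident.observe (h : GoodPath T δ φ v m F μ) (hs : Confident T v m F μ t s)
    (ht : t + 1 ≤ T) :
    Confident T v m F μ (t + 1) (s.observe T δ φ (t + 1) (v (t + 1)) (m (t + 1))) ∧
    Narrow T F μ (2 * cdfRadius T δ (t + 1)) (2 * φ (t + 1))
      (s.observe T δ φ (t + 1) (v (t + 1)) (m (t + 1))) := by
  have hsum : s.priceSum + m (t + 1) = ∑ i ∈ Finset.Icc 1 (t + 1), m i := by
    rw [hs.priceSum_eq, Finset.sum_Icc_succ_top (by omega)]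
  have hhits : ∀ x, s.bid ≤ x → x ≤ s.ask →
      s.hits x + (if clippedValuation s.bid s.ask (v (t + 1)) ≤ x then 1 else 0) =
        valuationCount v (t + 1) x := by
    intro x hb ha
    rw [hs.hits_eq x hb ha, valuationCount, valuationCount,
      Finset.sum_Icc_succ_top (by omega)]
    simp only [clippedValuation_le_iff hb ha]
  have hm := abs_le.1 (h.mean_close (t + 1) (by omega) ht)
  have hc : ∀ x ∈ s.active T, _ := fun x hx =>
    abs_le.1 (h.cdf_close (t + 1) (by omega) ht x (OPSRState.mem_active.1 hx).1)
  have hact : (s.observe T δ φ (t + 1) (v (t + 1)) (m (t + 1))).active T = s.active T := rfl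
  refine ⟨⟨hs.bid_mem, hs.ask_mem, ?_, ?_, hs.bid_le.trans (le_max_left _ _),
    (min_le_left _ _).trans hs.le_ask, hhits, hsum,
    fun x => (hs.cdfLow_nonneg x).trans (le_max_left _ _),
    fun x => (min_le_left _ _).trans (hs.cdfUp_le_one x), ?_, ?_, hs.bid_le_opt, hs.opt_le_ask⟩,
    ⟨?_, ?_, ?_, ?_⟩⟩
  · refine max_le hs.low_le ?_
    rw [hsum]; linarith
  · refine le_min hs.le_up ?_
    rw [hsum]; linarith
  · rw [hact]
    intro x hx
    obtain ⟨-, hb, ha⟩ := OPSRState.mem_active.1 hx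
    refine max_le (hs.cdfLow_le x hx) ?_
    beta_reduce
    rw [hhits x hb ha]; linarith [hc x hx]
  · rw [hact]
    intro x hx
    obtain ⟨-, hb, ha⟩ := OPSRState.mem_active.1 hx
    refine le_min (hs.le_cdfUp x hx) ?_
    beta_reduce
    rw [hhits x hb ha]; linarith [hc x hx]
  · have := le_max_right s.meanLow ((s.priceSum + m (t + 1)) / (t + 1 : ℕ) - φ (t + 1))
    simp only [OPSRState.observe]
    rw [hsum] at this ⊢; linarith
  · have := min_le_right s.meanUp ((s.priceSum + m (t + 1)) / (t + 1 : ℕ) + φ (t + 1))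
    simp only [OPSRState.observe]
    rw [hsum] at this ⊢; linarith
  · rw [hact]
    intro x hx
    obtain ⟨-, hb, ha⟩ := OPSRState.mem_active.1 hx
    have := le_max_right (s.cdfLow x)
      (valuationCount v (t + 1) x / (t + 1 : ℕ) - cdfRadius T δ (t + 1))
    simp only [OPSRState.observe]
    rw [hhits x hb ha]; linarith [hc x hx]
  · rw [hact]
    intro x hx
    obtain ⟨-, hb, ha⟩ := OPSRState.mem_active.1 hx
    have := min_le_right (s.cdfUp x)
      (valuationCount v (t + 1) x / (t + 1 : ℕ) + cdfRadius T δ (t + 1))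
    simp only [OPSRState.observe]
    rw [hhits x hb ha]; linarith [hc x hx]

theorem Confident.bid_candidates_nonempty (hs : Confident T v m F μ t s) :
    ∃ x ∈ s.bidCandidates T, x ≤ s.meanLow := by
  obtain ⟨x, hx, hxl, hc⟩ := exists_candidate_le (r := id) hs.bid_mem_active hs.bid_le
    (fun x _ => hs.cdfLow_nonneg x) hs.cdfLow_le hs.le_cdfUp
  exact ⟨x, OPSRState.mem_bidCandidates.2 ⟨hx, hc⟩, hxl⟩

/-- Translates between ask values and the rank `r = Neg.neg`, under which the ask side is an
instance of the bid side. -/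
theorem neg_sub_neg_mul (a b c : ℝ) : (-a - -b) * c = (b - a) * c := by ring

theorem Confident.ask_candidates_nonempty (hs : Confident T v m F μ t s) :
    ∃ x ∈ s.askCandidates T, s.meanUp ≤ x := by
  obtain ⟨x, hx, hxl, hc⟩ := exists_candidate_le (r := Neg.neg) (l := -s.meanUp)
    (lo := fun x => 1 - s.cdfUp x) (G := fun x => 1 - F x) (up := fun x => 1 - s.cdfLow x)
    hs.ask_mem_active (neg_le_neg hs.le_ask)
    (fun x _ => sub_nonneg.2 (hs.cdfUp_le_one x))
    (fun x hx => sub_le_sub_left (hs.le_cdfUp x hx) 1)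
    (fun x hx => sub_le_sub_left (hs.cdfLow_le x hx) 1)
  simp only [neg_sub_neg_mul] at hc
  exact ⟨x, OPSRState.mem_askCandidates.2 ⟨hx, hc⟩, by linarith⟩

theorem Confident.eliminate_bid (hs : Confident T v m F μ t s) :
    (s.eliminate T).bid ∈ s.bidCandidates T ∧
      ∀ x ∈ s.bidCandidates T, (s.eliminate T).bid ≤ x := by
  obtain ⟨x, hx, -⟩ := hs.bid_candidates_nonempty
  have hne : (s.bidCandidates T).Nonempty := ⟨x, hx⟩
  simp only [OPSRState.eliminate, dif_pos hne]
  exact ⟨Finset.min'_mem _ _, fun y hy => Finset.min'_le _ _ hy⟩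

theorem Confident.eliminate_ask (hs : Confident T v m F μ t s) :
    (s.eliminate T).ask ∈ s.askCandidates T ∧
      ∀ x ∈ s.askCandidates T, x ≤ (s.eliminate T).ask := by
  obtain ⟨x, hx, -⟩ := hs.ask_candidates_nonempty
  have hne : (s.askCandidates T).Nonempty := ⟨x, hx⟩
  simp only [OPSRState.eliminate, dif_pos hne]
  exact ⟨Finset.max'_mem _ _, fun y hy => Finset.le_max' _ _ hy⟩

/-- Some candidate bid is at most `meanLow`, hence so is the smallest one, and symmetrically for
asks. Grid optima stay between the quotes by `first_candidate_le_maximizer`. -/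
theorem Confident.eliminate (h : GoodPath T δ φ v m F μ) (hs : Confident T v m F μ t s) :
    Confident T v m F μ t (s.eliminate T) := by
  obtain ⟨hbc, hbmin⟩ := hs.eliminate_bid
  obtain ⟨hac, hamax⟩ := hs.eliminate_ask
  obtain ⟨hba, hbc'⟩ := OPSRState.mem_bidCandidates.1 hbc
  obtain ⟨haa, hac'⟩ := OPSRState.mem_askCandidates.1 hac
  obtain ⟨hbg, hb1, hb2⟩ := OPSRState.mem_active.1 hba
  obtain ⟨hag, ha1, ha2⟩ := OPSRState.mem_active.1 haa
  obtain ⟨x, hx, hxl⟩ := hs.bid_candidates_nonempty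
  obtain ⟨y, hy, hyl⟩ := hs.ask_candidates_nonempty
  have hsub : ∀ z ∈ (s.eliminate T).active T, z ∈ s.active T := fun z hz => by
    obtain ⟨h0, h1, h2⟩ := OPSRState.mem_active.1 hz
    exact OPSRState.mem_active.2 ⟨h0, hb1.trans h1, h2.trans ha2⟩
  refine ⟨hbg, hag, hs.low_le, hs.le_up, (hbmin x hx).trans hxl, hyl.trans (hamax y hy),
    fun z h1 h2 => hs.hits_eq z (hb1.trans h1) (h2.trans ha2), hs.priceSum_eq,
    hs.cdfLow_nonneg, hs.cdfUp_le_one, fun z hz => hs.cdfLow_le z (hsub z hz),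
    fun z hz => hs.le_cdfUp z (hsub z hz), ?_, ?_⟩
  · intro z hz hzμ hmax
    refine first_candidate_le_maximizer (r := id) (e := (s.eliminate T).bid) hs.low_le
      hs.bid_mem_active hs.bid_le
      (fun x _ => hs.cdfLow_nonneg x) hs.cdfLow_le hs.le_cdfUp (fun x _ y _ hxy => h.mono hxy)
      (fun w hw hc => hbmin w (OPSRState.mem_bidCandidates.2 ⟨hw, hc⟩))
      (OPSRState.mem_active.2 ⟨hz, hs.bid_le_opt z hz hzμ hmax,
        by linarith [hs.le_up, hs.le_ask]⟩)
      (fun w hw hwμ => hmax w (OPSRState.mem_active.1 hw).1 hwμ)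
  · intro z hz hzμ hmax
    refine neg_le_neg_iff.1 (first_candidate_le_maximizer (r := Neg.neg)
      (e := (s.eliminate T).ask)
      (l := -s.meanUp) (μ := -μ) (lo := fun x => 1 - s.cdfUp x) (G := fun x => 1 - F x)
      (up := fun x => 1 - s.cdfLow x) (neg_le_neg hs.le_up)
      hs.ask_mem_active (neg_le_neg hs.le_ask)
      (fun x _ => sub_nonneg.2 (hs.cdfUp_le_one x))
      (fun x hx => sub_le_sub_left (hs.le_cdfUp x hx) 1)
      (fun x hx => sub_le_sub_left (hs.cdfLow_le x hx) 1)
      (fun x _ y _ hxy => sub_le_sub_left (h.mono (neg_le_neg_iff.1 hxy)) 1)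
      (fun w hw hc => neg_le_neg (hamax w (OPSRState.mem_askCandidates.2 ⟨hw, ?_⟩)))
      (OPSRState.mem_active.2 ⟨hz, by linarith [hs.bid_le, hs.low_le],
        hs.opt_le_ask z hz hzμ hmax⟩)
      (fun w hw hwμ => ?_))
    · simp only [neg_sub_neg_mul] at hc
      exact hc
    · simpa only [neg_sub_neg_mul] using
        hmax w (OPSRState.mem_active.1 hw).1 (neg_le_neg_iff.1 hwμ)

/-- `candidate_gap` compares only with active prices. That suffices, because on each side of `μ` a
maximizer over the whole grid is still active. -/
theorem Confident.nearOptimal_eliminate {w d : ℝ} (hT : 1 ≤ T) (h : GoodPath T δ φ v m F μ)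
    (hs : Confident T v m F μ t s) (hn : Narrow T F μ w d s) :
    NearOptimal T F μ (d + 2 * w) (s.eliminate T) := by
  obtain ⟨hbc, hbmin⟩ := hs.eliminate_bid
  obtain ⟨hac, hamax⟩ := hs.eliminate_ask
  obtain ⟨hba, hbc'⟩ := OPSRState.mem_bidCandidates.1 hbc
  obtain ⟨haa, hac'⟩ := OPSRState.mem_askCandidates.1 hac
  have he := hs.eliminate h
  constructor
  · obtain ⟨y, hy, hymax⟩ := ((priceGrid T).filter (· ≤ μ)).exists_max_image
      (fun y => (μ - y) * F y)
      ⟨0, Finset.mem_filter.2 ⟨zero_mem_priceGrid T, h.mean_nonneg⟩⟩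
    simp only [Finset.mem_filter] at hy hymax
    have hgap := candidate_gap (r := id) (e := (s.eliminate T).bid) hs.low_le hs.cdfLow_le
      (fun x _ => hs.cdfLow_nonneg x) (fun x _ => h.le_one x) hn.cdfLow hn.cdfUp hn.low
      (fun x hx => by
        have := (mem_Icc_of_mem_priceGrid (OPSRState.mem_active.1 hx).1).1
        simp only [id]; linarith [h.mean_le_one]) hba he.bid_le hbc' (y := y)
      (OPSRState.mem_active.2 ⟨hy.1, hs.bid_le_opt y hy.1 hy.2 fun z hz hzμ => hymax z ⟨hz, hzμ⟩,
        by linarith [hs.le_up, hs.le_ask]⟩)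
    intro z hz hzμ
    simp only [id] at hgap
    linarith [hymax z ⟨hz, hzμ⟩]
  · obtain ⟨y, hy, hymax⟩ := ((priceGrid T).filter (μ ≤ ·)).exists_max_image
      (fun y => (y - μ) * (1 - F y))
      ⟨1, Finset.mem_filter.2 ⟨one_mem_priceGrid hT, h.mean_le_one⟩⟩
    simp only [Finset.mem_filter] at hy hymax
    have hgap := candidate_gap (r := Neg.neg) (l := -s.meanUp) (μ := -μ)
      (lo := fun x => 1 - s.cdfUp x) (G := fun x => 1 - F x)
      (up := fun x => 1 - s.cdfLow x) (e := (s.eliminate T).ask) (w := w) (d := d)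
      (neg_le_neg hs.le_up)
      (fun x hx => sub_le_sub_left (hs.le_cdfUp x hx) 1)
      (fun x _ => sub_nonneg.2 (hs.cdfUp_le_one x))
      (fun x _ => by linarith [h.nonneg x])
      (fun x hx => by linarith [hn.cdfUp x hx]) (fun x hx => by linarith [hn.cdfLow x hx])
      (by linarith [hn.up])
      (fun x hx => by
        have := (mem_Icc_of_mem_priceGrid (OPSRState.mem_active.1 hx).1).2
        linarith [h.mean_nonneg]) haa (neg_le_neg he.le_ask)
      (by simp only [neg_sub_neg_mul]; exact hac') (y := y)
      (OPSRState.mem_active.2 ⟨hy.1, by linarith [hs.bid_le, hs.low_le],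
        hs.opt_le_ask y hy.1 hy.2 fun z hz hzμ => hymax z ⟨hz, hzμ⟩⟩)
    intro z hz hzμ
    simp only [neg_sub_neg_mul] at hgap
    linarith [hymax z ⟨hz, hzμ⟩]

theorem Confident.eliminate_nested (hs : Confident T v m F μ t s) :
    s.bid ≤ (s.eliminate T).bid ∧ (s.eliminate T).ask ≤ s.ask :=
  ⟨(OPSRState.mem_active.1 (OPSRState.mem_bidCandidates.1 hs.eliminate_bid.1).1).2.1,
    (OPSRState.mem_active.1 (OPSRState.mem_askCandidates.1 hs.eliminate_ask.1).1).2.2⟩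

theorem GoodPath.confident (hT : 1 ≤ T) (h : GoodPath T δ φ v m F μ) :
    ∀ t ≤ T, Confident T v m F μ t (lazyOPSR T δ φ v m t)
  | 0, _ => h.confident_start hT
  | t + 1, ht => by
    have := ((h.confident hT t (by omega)).observe h ht).1
    simp only [lazyOPSR]
    split_ifs
    exacts [this.eliminate h, this]

theorem GoodPath.nested (hT : 1 ≤ T) (h : GoodPath T δ φ v m F μ) (ht : t + 1 ≤ T) :
    (lazyOPSR T δ φ v m t).bid ≤ (lazyOPSR T δ φ v m (t + 1)).bid ∧
      (lazyOPSR T δ φ v m (t + 1)).ask ≤ (lazyOPSR T δ φ v m t).ask := by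
  have := ((h.confident hT t (by omega)).observe h ht).1
  simp only [lazyOPSR]
  split_ifs
  exacts [this.eliminate_nested, ⟨le_rfl, le_rfl⟩]

/-- Between eliminations the quotes are frozen, and so is the dyadic index that measures their
margin. -/
theorem log_succ_eq_of_not_pow {t : ℕ} (ht : 1 ≤ t) (h : ¬ ∃ p, t + 1 = 2 ^ p) :
    Nat.log 2 (t + 1) = Nat.log 2 t := by
  refine le_antisymm ?_ (Nat.log_mono_right (Nat.le_succ t))
  refine Nat.le_log_of_pow_le one_lt_two ?_
  have h1 := Nat.pow_log_le_self 2 (x := t + 1) (by omega)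
  have h2 : 2 ^ Nat.log 2 (t + 1) ≠ t + 1 := fun h' => h ⟨_, h'.symm⟩
  omega

/-- The quotes chosen at the end of round `t` are near-optimal, with a margin given by the
radii at the last power of two. -/
theorem GoodPath.nearOptimal (hT : 1 ≤ T) (h : GoodPath T δ φ v m F μ) :
    ∀ t, 1 ≤ t → t ≤ T → NearOptimal T F μ
      (2 * φ (2 ^ Nat.log 2 t) + 4 * cdfRadius T δ (2 ^ Nat.log 2 t)) (lazyOPSR T δ φ v m t)
  | 0, h0, _ => by omega
  | t + 1, _, ht => by
    obtain ⟨hc, hn⟩ := (h.confident hT t (by omega)).observe h ht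
    by_cases hp : ∃ p, t + 1 = 2 ^ p
    · obtain ⟨p, hp'⟩ := hp
      have hpow : 2 ^ Nat.log 2 (t + 1) = t + 1 := by
        rw [hp', Nat.log_pow one_lt_two]
      have := hc.nearOptimal_eliminate hT h hn
      rw [hpow]
      simp only [lazyOPSR, if_pos (show ∃ p, t + 1 = 2 ^ p from ⟨p, hp'⟩)]
      convert this using 1
      ring
    · have ht1 : 1 ≤ t := by
        by_contra! h0
        exact hp ⟨0, by simp; omega⟩
      have := h.nearOptimal hT t ht1 (by omega)
      rw [log_succ_eq_of_not_pow ht1 hp]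
      simp only [lazyOPSR, if_neg hp]
      exact ⟨this.bid, this.ask⟩

end Confident

/-! ### Regret on a good path -/

/-- Expected reward of the quotes `b`, `a` at price `m` when bids are hit with probability `F b`
and asks with probability `Q a`. -/
def quoteValue (F Q : ℝ → ℝ) (b a m : ℝ) : ℝ := F b * (m - b) + Q a * (a - m)

/-- `Q` lies between the survival function `1 - F` and its left limit. -/
structure IsSurvival (F Q : ℝ → ℝ) : Prop where
  anti : Antitone Q
  ge : ∀ x, 1 - F x ≤ Q x
  le_one : ∀ x, Q x ≤ 1
  le_left : ∀ x y, x < y → Q y ≤ 1 - F x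

theorem mul_le_one_of_nonneg_of_le {x y : ℝ} (hx : 0 ≤ x) (hx1 : x ≤ 1) (hy : y ≤ 1) :
    x * y ≤ 1 :=
  (mul_le_of_le_one_right hx hy).trans hx1

/-- Summation by parts: the difference is a combination of partial sums with the nonnegative weights
`u (t + 1) - u t`, which telescope to `u T - u 1`. -/
theorem abs_sum_mul_sub_le {u x : ℕ → ℝ} {R : ℝ} {T : ℕ} (hT : 1 ≤ T)
    (hu : ∀ t, 1 ≤ t → t + 1 ≤ T → u t ≤ u (t + 1))
    (hR : ∀ t, 1 ≤ t → t ≤ T → |∑ s ∈ Finset.Icc 1 t, x s| ≤ R) :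
    |∑ t ∈ Finset.Icc 1 T, u t * x t - u T * ∑ t ∈ Finset.Icc 1 T, x t| ≤ (u T - u 1) * R := by
  induction T, hT using Nat.le_induction with
  | base => simp
  | succ n hn ih =>
    have ih := ih (fun t h1 h2 => hu t h1 (by omega)) (fun t h1 h2 => hR t h1 (by omega))
    rw [Finset.sum_Icc_succ_top (by omega), Finset.sum_Icc_succ_top (by omega)]
    have h1 : 0 ≤ u (n + 1) - u n := sub_nonneg.2 (hu n hn le_rfl)
    have h2 := abs_le.1 (hR n hn (by omega))
    rw [abs_le] at ih ⊢
    constructor <;> nlinarith [mul_le_mul_of_nonneg_left h2.1 h1, mul_le_mul_of_nonneg_left h2.2 h1]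

theorem abs_sum_mul_le_of_monotone {u x : ℕ → ℝ} {R : ℝ} {T : ℕ} (hT : 1 ≤ T)
    (hu : ∀ t, 1 ≤ t → t + 1 ≤ T → u t ≤ u (t + 1)) (h0 : ∀ t, 0 ≤ u t) (h1 : ∀ t, u t ≤ 1)
    (hR : ∀ t, 1 ≤ t → t ≤ T → |∑ s ∈ Finset.Icc 1 t, x s| ≤ R) :
    |∑ t ∈ Finset.Icc 1 T, u t * x t| ≤ 2 * R := by
  have h := abs_sum_mul_sub_le hT hu hR
  have hT' := hR T hT le_rfl
  have hR0 : 0 ≤ R := (abs_nonneg _).trans hT'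
  have h2 : |u T * ∑ t ∈ Finset.Icc 1 T, x t| ≤ 1 * R := by
    rw [abs_mul, abs_of_nonneg (h0 T)]
    exact mul_le_mul (h1 T) hT' (abs_nonneg _) zero_le_one
  have h3 : (u T - u 1) * R ≤ 1 * R :=
    mul_le_mul_of_nonneg_right (by linarith [h1 T, h0 1]) hR0
  rw [abs_le] at h h2 ⊢
  constructor <;> linarith

theorem exists_priceGrid_ge {T : ℕ} (hT : 1 ≤ T) {b : ℝ} (hb : b ∈ Set.Icc (0 : ℝ) 1) :
    ∃ y ∈ priceGrid T, b ≤ y ∧ y ≤ b + 1 / (⌈√(T : ℝ)⌉₊ : ℝ) := by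
  have hK : (0 : ℝ) < (⌈√(T : ℝ)⌉₊ : ℝ) := by exact_mod_cast ceil_sqrt_pos hT
  set K := ⌈√(T : ℝ)⌉₊
  refine ⟨(⌈b * K⌉₊ : ℝ) / K, Finset.mem_image.2 ⟨⌈b * K⌉₊, ?_, rfl⟩, ?_, ?_⟩
  · refine Finset.mem_range.2 (Nat.lt_succ_of_le (Nat.ceil_le.2 ?_))
    exact mul_le_of_le_one_left hK.le hb.2
  · rw [le_div_iff₀ hK]
    exact Nat.le_ceil _
  · rw [div_le_iff₀ hK, add_mul, one_div_mul_cancel hK.ne']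
    exact (Nat.ceil_lt_add_one (mul_nonneg hb.1 hK.le)).le

/-- Strictness is what `IsSurvival.le_left` requires: an ask rounded strictly down satisfies `Q a ≤
1 - F y` even if the valuation law has an atom at `a`. -/
theorem exists_priceGrid_lt {T : ℕ} (hT : 1 ≤ T) {a : ℝ} (ha : a ∈ Set.Ioc (0 : ℝ) 1) :
    ∃ y ∈ priceGrid T, y < a ∧ a ≤ y + 1 / (⌈√(T : ℝ)⌉₊ : ℝ) := by
  have hK : (0 : ℝ) < (⌈√(T : ℝ)⌉₊ : ℝ) := by exact_mod_cast ceil_sqrt_pos hT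
  set K := ⌈√(T : ℝ)⌉₊
  have hpos : 0 < ⌈a * K⌉₊ := Nat.ceil_pos.2 (mul_pos ha.1 hK)
  obtain ⟨n, hn⟩ : ∃ n, ⌈a * K⌉₊ = n + 1 := ⟨_, (Nat.succ_pred_eq_of_pos hpos).symm⟩
  have hle : ⌈a * K⌉₊ ≤ K := Nat.ceil_le.2 (mul_le_of_le_one_left hK.le ha.2)
  refine ⟨(n : ℝ) / K, Finset.mem_image.2 ⟨n, Finset.mem_range.2 (by omega), rfl⟩, ?_, ?_⟩
  · rw [div_lt_iff₀ hK]
    exact Nat.lt_ceil.1 (by omega)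
  · rw [← add_div, le_div_iff₀ hK]
    have := Nat.le_ceil (a * K)
    rw [hn] at this
    exact_mod_cast this

section Regret

variable {T : ℕ} {δ : ℝ} {φ : ℕ → ℝ} {v m : ℕ → ℝ} {F Q : ℝ → ℝ} {μ : ℝ} {t : ℕ} {s : OPSRState}

theorem IsSurvival.nonneg (hQ : IsSurvival F Q) (hF : ∀ x, F x ≤ 1) (x : ℝ) : 0 ≤ Q x :=
  (sub_nonneg.2 (hF x)).trans (hQ.ge x)

/-- Rounding the bid up does not lower `F` and costs one grid step. If the rounded bid passes `μ`,
the original one was already worth at most one step. -/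
theorem NearOptimal.bid_le {ε b : ℝ} (hT : 1 ≤ T) (h : GoodPath T δ φ v m F μ)
    (hs : Confident T v m F μ t s) (hn : NearOptimal T F μ ε s) (hε : 0 ≤ ε)
    (hb : b ∈ Set.Icc (0 : ℝ) 1) :
    F b * (μ - b) ≤ F s.bid * (μ - s.bid) + ε + 1 / (⌈√(T : ℝ)⌉₊ : ℝ) := by
  have hK : (0 : ℝ) ≤ 1 / (⌈√(T : ℝ)⌉₊ : ℝ) := by positivity
  have hs0 : 0 ≤ F s.bid * (μ - s.bid) :=
    mul_nonneg (h.nonneg _) (by linarith [hs.bid_le, hs.low_le])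
  obtain ⟨y, hy, hby, hyb⟩ := exists_priceGrid_ge hT hb
  rcases le_or_gt y μ with hyμ | hyμ
  · have h1 := hn.bid y hy hyμ
    have h2 : F b * (μ - y) ≤ F y * (μ - y) :=
      mul_le_mul_of_nonneg_right (h.mono hby) (by linarith)
    have h3 : F b * (y - b) ≤ 1 * (1 / (⌈√(T : ℝ)⌉₊ : ℝ)) :=
      mul_le_mul (h.le_one b) (by linarith) (by linarith) zero_le_one
    nlinarith
  · have h3 : F b * (μ - b) ≤ F b * (1 / (⌈√(T : ℝ)⌉₊ : ℝ)) :=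
      mul_le_mul_of_nonneg_left (by linarith) (h.nonneg b)
    have h4 := mul_le_mul_of_nonneg_right (h.le_one b) hK
    linarith

theorem NearOptimal.ask_le {ε a : ℝ} (hT : 1 ≤ T) (h : GoodPath T δ φ v m F μ)
    (hQ : IsSurvival F Q) (hs : Confident T v m F μ t s) (hn : NearOptimal T F μ ε s)
    (hε : 0 ≤ ε) (ha : a ∈ Set.Icc (0 : ℝ) 1) :
    Q a * (a - μ) ≤ Q s.ask * (s.ask - μ) + ε + 1 / (⌈√(T : ℝ)⌉₊ : ℝ) := by
  have hK : (0 : ℝ) ≤ 1 / (⌈√(T : ℝ)⌉₊ : ℝ) := by positivity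
  have hsμ : 0 ≤ s.ask - μ := by linarith [hs.le_ask, hs.le_up]
  have hs0 : 0 ≤ Q s.ask * (s.ask - μ) := mul_nonneg (hQ.nonneg h.le_one _) hsμ
  -- An ask not above `μ` earns nothing. In the remaining case `a > 0`, so a grid price strictly
  -- below `a` exists.
  rcases le_or_gt a μ with haμ | haμ
  · have := mul_nonpos_of_nonneg_of_nonpos (hQ.nonneg h.le_one a) (sub_nonpos.2 haμ)
    linarith
  obtain ⟨y, hy, hya, hay⟩ := exists_priceGrid_lt hT ⟨h.mean_nonneg.trans_lt haμ, ha.2⟩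
  rcases le_or_gt μ y with hyμ | hyμ
  · have h1 := hn.ask y hy hyμ
    have h2 : Q a * (y - μ) ≤ (1 - F y) * (y - μ) :=
      mul_le_mul_of_nonneg_right (hQ.le_left y a hya) (by linarith)
    have h3 : Q a * (a - y) ≤ 1 * (1 / (⌈√(T : ℝ)⌉₊ : ℝ)) :=
      mul_le_mul (hQ.le_one a) (by linarith) (by linarith) zero_le_one
    have h4 : (1 - F s.ask) * (s.ask - μ) ≤ Q s.ask * (s.ask - μ) :=
      mul_le_mul_of_nonneg_right (hQ.ge _) hsμ
    nlinarith
  · have h3 : Q a * (a - μ) ≤ Q a * (1 / (⌈√(T : ℝ)⌉₊ : ℝ)) :=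
      mul_le_mul_of_nonneg_left (by linarith) (hQ.nonneg h.le_one a)
    have h4 := mul_le_mul_of_nonneg_right (hQ.le_one a) hK
    linarith

theorem sum_Icc_one_eq_sum_range (f : ℕ → ℝ) (n : ℕ) :
    ∑ t ∈ Finset.Icc 1 n, f t = ∑ i ∈ Finset.range n, f (i + 1) := by
  induction n with
  | zero => simp
  | succ n ih => rw [Finset.sum_Icc_succ_top (by omega), ih, Finset.sum_range_succ]

theorem natCast_div_ceil_sqrt_le (T : ℕ) : (T : ℝ) * (1 / (⌈√(T : ℝ)⌉₊ : ℝ)) ≤ √T := by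
  rcases Nat.eq_zero_or_pos T with rfl | hT
  · simp
  have h := Nat.le_ceil √(T : ℝ)
  have h0 : 0 < √(T : ℝ) := Real.sqrt_pos.2 (by exact_mod_cast hT)
  rw [mul_one_div, div_le_iff₀ (h0.trans_le h)]
  nlinarith [Real.mul_self_sqrt (Nat.cast_nonneg (α := ℝ) T)]

/-- Regret against the mean price. -/
theorem GoodPath.sum_mean_le (hT : 1 ≤ T) (h : GoodPath T δ φ v m F μ) (hQ : IsSurvival F Q)
    {a b : ℝ} (hb : b ∈ Set.Icc (0 : ℝ) 1) (ha : a ∈ Set.Icc (0 : ℝ) 1) :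
    ∑ t ∈ Finset.Icc 1 T, (quoteValue F Q b a μ -
        quoteValue F Q (lazyQuotes T δ φ v m t).1 (lazyQuotes T δ φ v m t).2 μ) ≤
      2 + 2 * √T + ∑ i ∈ Finset.range (T - 1),
        (4 * φ (2 ^ Nat.log 2 (i + 1)) + 8 * cdfRadius T δ (2 ^ Nat.log 2 (i + 1))) := by
  obtain ⟨n, rfl⟩ : ∃ n, T = n + 1 := ⟨T - 1, by omega⟩
  rw [sum_Icc_one_eq_sum_range, Finset.sum_range_succ']
  set K : ℝ := 1 / (⌈√((n + 1 : ℕ) : ℝ)⌉₊ : ℝ) with hKdef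
  have hK : 0 ≤ K := by positivity
  -- Round `1` is played with the initial quotes `(0, 1)` and costs at most `2`. Round `i + 2` uses
  -- the quotes fixed at the end of round `i + 1`.
  have hfirst : quoteValue F Q b a μ - quoteValue F Q (lazyQuotes (n + 1) δ φ v m (0 + 1)).1
      (lazyQuotes (n + 1) δ φ v m (0 + 1)).2 μ ≤ 2 := by
    have h1 : F b * (μ - b) ≤ 1 :=
      mul_le_one_of_nonneg_of_le (h.nonneg b) (h.le_one b) (by linarith [hb.1, h.mean_le_one])
    have h2 : Q a * (a - μ) ≤ 1 :=
      mul_le_one_of_nonneg_of_le (hQ.nonneg h.le_one a) (hQ.le_one a)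
        (by linarith [ha.2, h.mean_nonneg])
    have h3 : 0 ≤ F 0 * (μ - 0) := mul_nonneg (h.nonneg 0) (by linarith [h.mean_nonneg])
    have h4 : 0 ≤ Q 1 * (1 - μ) :=
      mul_nonneg (hQ.nonneg h.le_one 1) (by linarith [h.mean_le_one])
    simp only [lazyQuotes, quoteValue, Nat.add_sub_cancel, lazyOPSR, OPSRState.start]
    linarith
  have hrest : ∑ i ∈ Finset.range n, (quoteValue F Q b a μ -
      quoteValue F Q (lazyQuotes (n + 1) δ φ v m (i + 1 + 1)).1
        (lazyQuotes (n + 1) δ φ v m (i + 1 + 1)).2 μ) ≤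
      ∑ i ∈ Finset.range n, ((4 * φ (2 ^ Nat.log 2 (i + 1)) +
        8 * cdfRadius (n + 1) δ (2 ^ Nat.log 2 (i + 1))) + 2 * K) := by
    refine Finset.sum_le_sum fun i hi => ?_
    have hi' : i + 1 ≤ n + 1 := by have := Finset.mem_range.1 hi; omega
    have hs := h.confident hT (i + 1) hi'
    have hn := h.nearOptimal hT (i + 1) (by omega) hi'
    set p := 2 ^ Nat.log 2 (i + 1)
    have hp1 : 1 ≤ p := Nat.one_le_two_pow
    have hp2 : p ≤ n + 1 := (Nat.pow_log_le_self 2 (by omega)).trans hi'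
    have hε : 0 ≤ 2 * φ p + 4 * cdfRadius (n + 1) δ p := by
      have h1 := (abs_nonneg _).trans (h.mean_close p hp1 hp2)
      have h2 : 0 ≤ cdfRadius (n + 1) δ p := Real.sqrt_nonneg _
      linarith
    have h1 := hn.bid_le hT h hs hε hb
    have h2 := hn.ask_le hT h hQ hs hε ha
    simp only [lazyQuotes, quoteValue, Nat.add_sub_cancel]
    linarith
  rw [Finset.sum_add_distrib, Finset.sum_const, Finset.card_range, nsmul_eq_mul] at hrest
  have hTK := natCast_div_ceil_sqrt_le (n + 1)
  rw [← hKdef] at hTK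
  simp only [zero_add] at hfirst
  push_cast at hTK ⊢
  have : (n : ℝ) * (2 * K) ≤ 2 * √(n + 1) := by nlinarith
  linarith

/-- Regret on a good path, when the prices fluctuate by at most `R` around their mean. -/
theorem GoodPath.sum_le (hT : 1 ≤ T) (h : GoodPath T δ φ v m F μ) (hQ : IsSurvival F Q) {R : ℝ}
    (hR : ∀ t, 1 ≤ t → t ≤ T → |∑ s ∈ Finset.Icc 1 t, (m s - μ)| ≤ R)
    {a b : ℝ} (hb : b ∈ Set.Icc (0 : ℝ) 1) (ha : a ∈ Set.Icc (0 : ℝ) 1) :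
    ∑ t ∈ Finset.Icc 1 T, (quoteValue F Q b a (m t) -
        quoteValue F Q (lazyQuotes T δ φ v m t).1 (lazyQuotes T δ φ v m t).2 (m t)) ≤
      2 + 2 * √T + ∑ i ∈ Finset.range (T - 1),
        (4 * φ (2 ^ Nat.log 2 (i + 1)) + 8 * cdfRadius T δ (2 ^ Nat.log 2 (i + 1))) +
      5 * R := by
  -- The slope in the price is `F b - Q a`. The benchmark contributes at most `R` and each of the
  -- two monotone weights `2 * R`, hence `5 * R`.
  have hsplit : ∑ t ∈ Finset.Icc 1 T, (quoteValue F Q b a (m t) -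
        quoteValue F Q (lazyQuotes T δ φ v m t).1 (lazyQuotes T δ φ v m t).2 (m t)) =
      ∑ t ∈ Finset.Icc 1 T, (quoteValue F Q b a μ -
        quoteValue F Q (lazyQuotes T δ φ v m t).1 (lazyQuotes T δ φ v m t).2 μ) +
      ((F b - Q a) * ∑ t ∈ Finset.Icc 1 T, (m t - μ) -
        ∑ t ∈ Finset.Icc 1 T, F (lazyQuotes T δ φ v m t).1 * (m t - μ) +
        ∑ t ∈ Finset.Icc 1 T, Q (lazyQuotes T δ φ v m t).2 * (m t - μ)) := by
    rw [Finset.mul_sum, ← Finset.sum_sub_distrib, ← Finset.sum_add_distrib,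
      ← Finset.sum_add_distrib]
    refine Finset.sum_congr rfl fun t _ => ?_
    simp only [quoteValue]
    ring
  have hnest : ∀ t, 1 ≤ t → t + 1 ≤ T →
      (lazyQuotes T δ φ v m t).1 ≤ (lazyQuotes T δ φ v m (t + 1)).1 ∧
      (lazyQuotes T δ φ v m (t + 1)).2 ≤ (lazyQuotes T δ φ v m t).2 := by
    intro t ht htT
    obtain ⟨r, rfl⟩ : ∃ r, t = r + 1 := ⟨t - 1, by omega⟩
    exact h.nested hT (t := r) (by omega)
  have h1 := abs_sum_mul_le_of_monotone hT (u := fun t => F (lazyQuotes T δ φ v m t).1)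
    (fun t h1 h2 => h.mono (hnest t h1 h2).1) (fun _ => h.nonneg _) (fun _ => h.le_one _) hR
  have h2 := abs_sum_mul_le_of_monotone hT (u := fun t => Q (lazyQuotes T δ φ v m t).2)
    (fun t h1 h2 => hQ.anti (hnest t h1 h2).2) (fun _ => hQ.nonneg h.le_one _)
    (fun _ => hQ.le_one _) hR
  have h3 : |(F b - Q a) * ∑ t ∈ Finset.Icc 1 T, (m t - μ)| ≤ 1 * R := by
    rw [abs_mul]
    refine mul_le_mul (abs_le.2 ⟨?_, ?_⟩) (hR T hT le_rfl) (abs_nonneg _) zero_le_one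
    · linarith [h.nonneg b, hQ.le_one a]
    · linarith [h.le_one b, hQ.nonneg h.le_one a]
  have h0 := h.sum_mean_le hT hQ hb ha
  rw [hsplit]
  linarith [(abs_le.1 h1).1, (abs_le.1 h2).2, (abs_le.1 h3).2]

/-! ### Trivial bound -/

/-- Valid on every path, good or not, which gives the trivial regret bound needed for short
horizons. -/
theorem lazyOPSR_mem_priceGrid (hT : 1 ≤ T) (t : ℕ) :
    (lazyOPSR T δ φ v m t).bid ∈ priceGrid T ∧ (lazyOPSR T δ φ v m t).ask ∈ priceGrid T := by
  induction t with
  | zero => exact ⟨zero_mem_priceGrid T, one_mem_priceGrid hT⟩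
  | succ t ih =>
    simp only [lazyOPSR]
    split_ifs
    · simp only [OPSRState.eliminate]
      constructor
      · split_ifs with h
        · exact (OPSRState.mem_active.1
            (OPSRState.mem_bidCandidates.1 (Finset.min'_mem _ h)).1).1
        · exact ih.1
      · split_ifs with h
        · exact (OPSRState.mem_active.1
            (OPSRState.mem_askCandidates.1 (Finset.max'_mem _ h)).1).1
        · exact ih.2
    · exact ih

theorem abs_quoteValue_le {b a m : ℝ} (hF : ∀ x, F x ∈ Set.Icc (0 : ℝ) 1)
    (hQ : ∀ x, Q x ∈ Set.Icc (0 : ℝ) 1) (hb : b ∈ Set.Icc (0 : ℝ) 1)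
    (ha : a ∈ Set.Icc (0 : ℝ) 1) (hm : m ∈ Set.Icc (0 : ℝ) 1) : |quoteValue F Q b a m| ≤ 2 := by
  have h1 : |F b * (m - b)| ≤ 1 * 1 := by
    rw [abs_mul, abs_of_nonneg (hF b).1]
    exact mul_le_mul (hF b).2 (abs_le.2 ⟨by linarith [hb.2, hm.1], by linarith [hb.1, hm.2]⟩)
      (abs_nonneg _) zero_le_one
  have h2 : |Q a * (a - m)| ≤ 1 * 1 := by
    rw [abs_mul, abs_of_nonneg (hQ a).1]
    exact mul_le_mul (hQ a).2 (abs_le.2 ⟨by linarith [ha.1, hm.2], by linarith [ha.2, hm.1]⟩)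
      (abs_nonneg _) zero_le_one
  exact (abs_add_le _ _).trans (by linarith)

theorem sum_quoteValue_sub_le (hT : 1 ≤ T) (hF : ∀ x, F x ∈ Set.Icc (0 : ℝ) 1)
    (hQ : IsSurvival F Q) (hm : ∀ t ∈ Set.Icc 1 T, m t ∈ Set.Icc (0 : ℝ) 1)
    {a b : ℝ} (hb : b ∈ Set.Icc (0 : ℝ) 1) (ha : a ∈ Set.Icc (0 : ℝ) 1) :
    ∑ t ∈ Finset.Icc 1 T, (quoteValue F Q b a (m t) -
        quoteValue F Q (lazyQuotes T δ φ v m t).1 (lazyQuotes T δ φ v m t).2 (m t)) ≤ 4 * T := by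
  have hQ' : ∀ x, Q x ∈ Set.Icc (0 : ℝ) 1 := fun x =>
    ⟨hQ.nonneg (fun x => (hF x).2) x, hQ.le_one x⟩
  calc _ ≤ ∑ t ∈ Finset.Icc 1 T, (4 : ℝ) := Finset.sum_le_sum fun t ht => by
        have hmt := hm t (by simpa using ht)
        have hg := lazyOPSR_mem_priceGrid (δ := δ) (φ := φ) (v := v) (m := m) hT (t - 1)
        have h1 := abs_le.1 (abs_quoteValue_le hF hQ' hb ha hmt)
        have h2 := abs_le.1 (abs_quoteValue_le hF hQ' (mem_Icc_of_mem_priceGrid hg.1)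
          (mem_Icc_of_mem_priceGrid hg.2) hmt)
        simp only [lazyQuotes]
        linarith [h1.2, h2.1]
    _ = 4 * T := by simp [mul_comm]

end Regret

/-! ### Sums over dyadic epochs -/

/-- An epoch starting at `2 ^ q` has `2 ^ q` rounds and contributes exactly `1`. -/
theorem sum_inv_two_pow_log (p : ℕ) :
    ∑ i ∈ Finset.range (2 ^ p - 1), ((2 ^ Nat.log 2 (i + 1) : ℕ) : ℝ)⁻¹ = p := by
  induction p with
  | zero => simp
  | succ p ih =>
    have hp : 1 ≤ 2 ^ p := Nat.one_le_two_pow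
    rw [show 2 ^ (p + 1) - 1 = (2 ^ p - 1) + 2 ^ p by rw [pow_succ]; omega,
      Finset.sum_range_add, ih]
    have hconst : ∀ i ∈ Finset.range (2 ^ p),
        ((2 ^ Nat.log 2 (2 ^ p - 1 + i + 1) : ℕ) : ℝ)⁻¹ = ((2 : ℝ) ^ p)⁻¹ := by
      intro i hi
      have hi := Finset.mem_range.1 hi
      rw [Nat.log_eq_of_pow_le_of_lt_pow (m := p) (by omega) (by rw [pow_succ]; omega)]
      simp
    rw [Finset.sum_congr rfl hconst]
    simp

theorem sum_inv_two_pow_log_le {T : ℕ} (hT : 1 ≤ T) :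
    ∑ i ∈ Finset.range (T - 1), ((2 ^ Nat.log 2 (i + 1) : ℕ) : ℝ)⁻¹ ≤
      Real.log T / Real.log 2 + 1 := by
  have hlt := Nat.lt_pow_succ_log_self one_lt_two T
  have hle := Nat.pow_log_le_self 2 (x := T) (by omega)
  calc _ ≤ ∑ i ∈ Finset.range (2 ^ (Nat.log 2 T + 1) - 1),
        ((2 ^ Nat.log 2 (i + 1) : ℕ) : ℝ)⁻¹ :=
        Finset.sum_le_sum_of_subset_of_nonneg (Finset.range_mono (by omega))
          fun _ _ _ => by positivity
    _ = Nat.log 2 T + 1 := by rw [sum_inv_two_pow_log]; push_cast; ring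
    _ ≤ _ := by
        gcongr
        rw [le_div_iff₀ (Real.log_pos one_lt_two), ← Real.log_pow]
        exact Real.log_le_log (by positivity) (by exact_mod_cast hle)

/-- Since `i + 2` is at most twice the last power of two, each term is at most `√2 / √n` with `n = i
+ 2`. Then `1 / √n ≤ 2 * (√n - √(n - 1))` telescopes. -/
theorem sum_sqrt_inv_two_pow_log_le {T : ℕ} (hT : 1 ≤ T) :
    ∑ i ∈ Finset.range (T - 1), √((2 ^ Nat.log 2 (i + 1) : ℕ) : ℝ)⁻¹ ≤ 2 * √2 * √T := by
  have hterm : ∀ i ∈ Finset.range (T - 1), √((2 ^ Nat.log 2 (i + 1) : ℕ) : ℝ)⁻¹ ≤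
      2 * √2 * (√((i + 1 : ℕ) + 1 : ℝ) - √((i : ℕ) + 1 : ℝ)) := by
    intro i _
    have hlt := Nat.lt_pow_succ_log_self one_lt_two (i + 1)
    rw [pow_succ] at hlt
    have h1 : ((2 ^ Nat.log 2 (i + 1) : ℕ) : ℝ)⁻¹ ≤ 2 * ((i : ℝ) + 2)⁻¹ := by
      have : ((i : ℝ) + 2) ≤ (2 ^ Nat.log 2 (i + 1) : ℕ) * 2 := by exact_mod_cast hlt
      have h2 : (0 : ℝ) < (2 ^ Nat.log 2 (i + 1) : ℕ) := by positivity
      rw [← div_eq_mul_inv, inv_le_iff_one_le_mul₀ h2, div_mul_eq_mul_div,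
        one_le_div (by positivity)]
      linarith
    refine (Real.sqrt_le_sqrt h1).trans ?_
    rw [Real.sqrt_mul zero_le_two, Real.sqrt_inv, mul_comm 2 (√2), mul_assoc]
    refine mul_le_mul_of_nonneg_left ?_ (Real.sqrt_nonneg _)
    push_cast
    rw [show (i : ℝ) + 1 + 1 = i + 2 by ring]
    have ha : 0 < √((i : ℝ) + 2) := Real.sqrt_pos.2 (by positivity)
    have ha2 := Real.sq_sqrt (show (0 : ℝ) ≤ i + 2 by positivity)
    have hb2 := Real.sq_sqrt (show (0 : ℝ) ≤ i + 1 by positivity)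
    rw [inv_le_iff_one_le_mul₀ ha]
    nlinarith [sq_nonneg (√((i : ℝ) + 2) - √((i : ℝ) + 1))]
  refine (Finset.sum_le_sum hterm).trans ?_
  rw [← Finset.mul_sum, Finset.sum_range_sub fun i : ℕ => √((i : ℝ) + 1)]
  obtain ⟨n, rfl⟩ : ∃ n, T = n + 1 := ⟨T - 1, by omega⟩
  refine mul_le_mul_of_nonneg_left ?_ (by positivity)
  simp

/-! ### From quote values to the regret of LazyOPSR -/

section RegretBounds

variable {T : ℕ} {δ : ℝ} {φ : ℕ → ℝ} {v m : ℕ → ℝ} {ν : Measure ℝ} [IsProbabilityMeasure ν]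

theorem cdf_mem_Icc (ν : Measure ℝ) (x : ℝ) : cdf ν x ∈ Set.Icc (0 : ℝ) 1 :=
  ⟨cdf_nonneg ν x, cdf_le_one ν x⟩

theorem isSurvival_one_sub_cdf (ν : Measure ℝ) : IsSurvival (cdf ν) fun x => 1 - cdf ν x where
  anti := fun _ _ h => sub_le_sub_left (monotone_cdf ν h) 1
  ge := fun _ => le_rfl
  le_one := fun x => by linarith [cdf_nonneg ν x]
  le_left := fun _ _ h => sub_le_sub_left (monotone_cdf ν h.le) 1

theorem one_sub_cdf_eq (ν : Measure ℝ) [IsProbabilityMeasure ν] (x : ℝ) :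
    1 - cdf ν x = ν.real (Set.Ioi x) := by
  rw [cdf_eq_real, ← Set.compl_Iic, probReal_compl_eq_one_sub measurableSet_Iic]

theorem isSurvival_Ici (ν : Measure ℝ) [IsProbabilityMeasure ν] :
    IsSurvival (cdf ν) fun x => ν.real (Set.Ici x) where
  anti := fun _ _ h => measureReal_mono (Set.Ici_subset_Ici.2 h)
  ge := fun x => by
    rw [one_sub_cdf_eq]
    exact measureReal_mono Set.Ioi_subset_Ici_self
  le_one := fun x => measureReal_le_one
  le_left := fun x y h => by
    rw [one_sub_cdf_eq]
    exact measureReal_mono (Set.Ici_subset_Ioi.2 h)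

theorem reward_eq_indicator (b a m : ℝ) :
    (fun v => reward b a v m) = fun v =>
      (Set.Iic b).indicator (fun _ => m - b) v + (Set.Ici a).indicator (fun _ => a - m) v := by
  ext v
  simp [reward, Set.indicator]

theorem integrable_reward (ν : Measure ℝ) [IsProbabilityMeasure ν] (b a m : ℝ) :
    Integrable (fun v => reward b a v m) ν := by
  rw [reward_eq_indicator]
  exact ((integrable_const _).indicator measurableSet_Iic).add
    ((integrable_const _).indicator measurableSet_Ici)

theorem integral_reward (ν : Measure ℝ) [IsProbabilityMeasure ν] (b a m : ℝ) :
    ∫ v, reward b a v m ∂ν = quoteValue (cdf ν) (fun x => ν.real (Set.Ici x)) b a m := by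
  rw [reward_eq_indicator, integral_add ((integrable_const _).indicator measurableSet_Iic)
    ((integrable_const _).indicator measurableSet_Ici), integral_indicator_const _ measurableSet_Iic,
    integral_indicator_const _ measurableSet_Ici, quoteValue, cdf_eq_real]
  simp

/-- The two forms of regret differ only in the probability that an ask is filled, `ν.real (Set.Ici
a)` or `1 - cdf ν a`. A bound uniform in `Q` covers both, atoms included. -/
theorem lazyRegret_le {X : ℝ}
    (h : ∀ Q, IsSurvival (cdf ν) Q → ∀ b ∈ Set.Icc (0 : ℝ) 1, ∀ a ∈ Set.Icc (0 : ℝ) 1,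
      ∑ t ∈ Finset.Icc 1 T, (quoteValue (cdf ν) Q b a (m t) -
        quoteValue (cdf ν) Q (lazyQuotes T δ φ v m t).1 (lazyQuotes T δ φ v m t).2 (m t)) ≤ X) :
    lazyRegret ν T δ φ v m ≤ X := by
  have : Nonempty (Set.Icc (0 : ℝ) 1 × Set.Icc (0 : ℝ) 1) :=
    ⟨⟨0, by simp⟩, ⟨0, by simp⟩⟩
  refine max_le (ciSup_le fun p => ?_) (ciSup_le fun p => ?_)
  · refine le_trans (le_of_eq (Finset.sum_congr rfl fun t _ => ?_))
      (h _ (isSurvival_Ici ν) p.1 p.1.2 p.2 p.2.2)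
    rw [integral_sub (integrable_reward ν _ _ _) (integrable_reward ν _ _ _), integral_reward,
      integral_reward]
  · exact h _ (isSurvival_one_sub_cdf ν) p.1 p.1.2 p.2 p.2.2

theorem lazyRegret_le_trivial (hT : 1 ≤ T) (hm : ∀ t ∈ Set.Icc 1 T, m t ∈ Set.Icc (0 : ℝ) 1) :
    lazyRegret ν T δ φ v m ≤ 4 * T :=
  lazyRegret_le fun _ hQ _ hb _ ha => sum_quoteValue_sub_le hT (cdf_mem_Icc ν) hQ hm hb ha

theorem sqrt_mul_inv_eq (x n : ℝ) (hx : 0 ≤ x) : √(x / n) = √x * √n⁻¹ := by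
  rw [div_eq_mul_inv, Real.sqrt_mul hx]

/-- Regret on a good path for a radius of order `√(L / n) + g / n`. -/
theorem GoodPath.lazyRegret_le {μ c g L : ℝ} (hT : 1 ≤ T) (h : GoodPath T δ φ v m (cdf ν) μ)
    (hg : 0 ≤ g) (hc : 0 ≤ c) (hL : L = Real.log (3 * T / δ)) (hL0 : 0 ≤ L)
    (hφ : ∀ n : ℕ, 1 ≤ n → φ n ≤ c * √L * √(n : ℝ)⁻¹ + g * (n : ℝ)⁻¹) :
    lazyRegret ν T δ φ v m ≤ 4 * √T + (8 * √2 * c + 8 * √6 + 5 * c) * (√L * √T) +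
      g * (4 * (Real.log T / Real.log 2 + 1) + 5) := by
  have hψ : ∀ n : ℕ, cdfRadius T δ n = √(3 / 4) * √L * √(n : ℝ)⁻¹ := fun n => by
    rw [cdfRadius, ← hL, ← Real.sqrt_mul (by norm_num), ← sqrt_mul_inv_eq _ _ (by positivity)]
    congr 1
    rw [mul_div_mul_comm]
    ring
  have hR : ∀ t, 1 ≤ t → t ≤ T →
      |∑ s ∈ Finset.Icc 1 t, (m s - μ)| ≤ c * (√L * √T) + g := by
    intro t ht htT
    have ht0 : (0 : ℝ) < t := by exact_mod_cast ht
    have h1 := (h.mean_close t ht htT).trans (hφ t ht)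
    have h2 : ∑ s ∈ Finset.Icc 1 t, (m s - μ) = t * ((∑ s ∈ Finset.Icc 1 t, m s) / t - μ) := by
      rw [Finset.sum_sub_distrib, mul_sub, mul_div_cancel₀ _ ht0.ne']
      simp
    rw [h2, abs_mul, abs_of_pos ht0]
    have h3 : (t : ℝ) * √(t : ℝ)⁻¹ ≤ √T := by
      rw [Real.sqrt_inv, ← div_eq_mul_inv, Real.div_sqrt]
      exact Real.sqrt_le_sqrt (by exact_mod_cast htT)
    calc (t : ℝ) * |(∑ s ∈ Finset.Icc 1 t, m s) / t - μ|
        ≤ t * (c * √L * √(t : ℝ)⁻¹ + g * (t : ℝ)⁻¹) := mul_le_mul_of_nonneg_left h1 ht0.le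
      _ = c * √L * (t * √(t : ℝ)⁻¹) + g * (t * (t : ℝ)⁻¹) := by ring
      _ ≤ c * √L * √T + g * 1 := by
          rw [mul_inv_cancel₀ ht0.ne']
          gcongr
      _ = _ := by ring
  refine _root_.lazyRegret_le fun Q hQ b hb a ha => (h.sum_le hT hQ hR hb ha).trans ?_
  have hsum : ∑ i ∈ Finset.range (T - 1), (4 * φ (2 ^ Nat.log 2 (i + 1)) +
        8 * cdfRadius T δ (2 ^ Nat.log 2 (i + 1))) ≤
      (4 * c + 8 * √(3 / 4)) * √L * (2 * √2 * √T) +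
        4 * g * (Real.log T / Real.log 2 + 1) := by
    calc _ ≤ ∑ i ∈ Finset.range (T - 1), ((4 * c + 8 * √(3 / 4)) * √L *
            √((2 ^ Nat.log 2 (i + 1) : ℕ) : ℝ)⁻¹ +
            4 * g * ((2 ^ Nat.log 2 (i + 1) : ℕ) : ℝ)⁻¹) := by
          refine Finset.sum_le_sum fun i _ => ?_
          have := hφ (2 ^ Nat.log 2 (i + 1)) Nat.one_le_two_pow
          rw [hψ]
          linarith
      _ ≤ _ := by
          rw [Finset.sum_add_distrib, ← Finset.mul_sum, ← Finset.mul_sum]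
          gcongr
          · exact sum_sqrt_inv_two_pow_log_le hT
          · exact sum_inv_two_pow_log_le hT
  have h1 : 1 ≤ √(T : ℝ) := Real.one_le_sqrt.2 (by exact_mod_cast hT)
  have h6 : √(3 / 4 : ℝ) * √2 = √6 / 2 := by
    rw [← Real.sqrt_mul (by norm_num), show (3 / 4 * 2 : ℝ) = 6 / 2 ^ 2 by norm_num,
      Real.sqrt_div' _ (by positivity), Real.sqrt_sq (by norm_num)]
  have h7 : (4 * c + 8 * √(3 / 4)) * √L * (2 * √2 * √T) =
      (8 * √2 * c + 8 * √6) * (√L * √T) := by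
    calc _ = (8 * √2 * c + 16 * (√(3 / 4) * √2)) * (√L * √T) := by ring
      _ = _ := by rw [h6]; ring
  rw [h7] at hsum
  linarith

theorem const_mul_sqrt_mul_sqrt_le {κ r L D : ℝ} {T : ℕ} (hκ : κ ≤ r) (hL : 0 ≤ L)
    (hD : r ^ 2 ≤ D) : κ * (√L * √T) ≤ √(D * T * L) := by
  rw [mul_assoc D, mul_comm (T : ℝ), Real.sqrt_mul ((sq_nonneg r).trans hD),
    Real.sqrt_mul hL]
  exact mul_le_mul_of_nonneg_right (hκ.trans (Real.le_sqrt_of_sq_le hD)) (by positivity)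

theorem log_div_half {c T δ : ℝ} : Real.log (c * T / (δ / 2)) = Real.log (2 * c * T / δ) := by
  congr 1
  rw [div_div_eq_mul_div]
  ring

theorem log_six_nonneg {T : ℕ} {δ : ℝ} (hT : 1 ≤ T) (hδ : 0 < δ) (hδ1 : δ < 1) :
    0 ≤ Real.log (6 * T / δ) := by
  refine Real.log_nonneg ((one_le_div hδ).2 ?_)
  have : (1 : ℝ) ≤ T := by exact_mod_cast hT
  linarith

theorem log_four_le {T : ℕ} {δ : ℝ} (hT : 1 ≤ T) (hδ : 0 < δ) :
    Real.log (2 * T / (δ / 2)) ≤ Real.log (6 * T / δ) := by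
  have : (1 : ℝ) ≤ T := by exact_mod_cast hT
  rw [log_div_half]
  refine Real.log_le_log (by positivity) ?_
  gcongr
  norm_num

theorem four_mul_le_of_lt {T : ℕ} (h : T ≤ 64) : 4 * (T : ℝ) ≤ 32 * √T := by
  have h0 := Real.sqrt_nonneg (T : ℝ)
  have h1 := Real.mul_self_sqrt (Nat.cast_nonneg (α := ℝ) T)
  have h2 : √(T : ℝ) ≤ 8 := Real.sqrt_le_iff.2 ⟨by norm_num, by norm_num; exact_mod_cast h⟩
  nlinarith

theorem GoodPath.lazyRegret_local_le {μ γ : ℝ} {k : ℕ} (hT : 64 < T) (hδ : 0 < δ) (hδ1 : δ < 1)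
    (hγ : 0 ≤ γ) (hγ1 : γ < 1)
    (h : GoodPath T (δ / 2) (localRadius T (δ / 2) γ k) v m (cdf ν) μ) :
    lazyRegret ν T (δ / 2) (localRadius T (δ / 2) γ k) v m ≤
      √(2007 * T * Real.log (6 * T / δ)) + 8 * γ * (k + 1) * Real.log T / (1 - γ) +
        32 * √T := by
  have hT1 : 1 ≤ T := by omega
  have hL0 := log_six_nonneg hT1 hδ hδ1
  set g := γ * (k + 1) / (1 - γ) with hgdef
  have hg : 0 ≤ g := div_nonneg (by positivity) (by linarith)
  -- `3 / 4` exceeds `1 / √2`, and the logarithm in the radius is `log (4 * T / δ) ≤ log (6 * T /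
  -- δ)`.
  have hmain := h.lazyRegret_le hT1 (c := 3 / 4) (L := Real.log (6 * T / δ)) hg (by norm_num)
    (by rw [log_div_half]; norm_num) hL0 (fun n hn => by
      have hn0 : (0 : ℝ) < n := by exact_mod_cast hn
      rw [localRadius]
      gcongr ?_ + ?_
      · refine Real.sqrt_le_iff.2 ⟨by positivity, ?_⟩
        rw [mul_pow, mul_pow, Real.sq_sqrt hL0, Real.sq_sqrt (by positivity), mul_comm (2 : ℝ) n,
          ← div_div, div_eq_mul_inv _ (n : ℝ), mul_div_right_comm]
        refine mul_le_mul_of_nonneg_right ?_ (by positivity)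
        linarith [log_four_le hT1 hδ]
      · rw [hgdef, ← div_div, div_eq_mul_inv _ (n : ℝ)])
  have h2 : √(2 : ℝ) ≤ 1.415 := Real.sqrt_le_iff.2 (by norm_num)
  have h6 : √(6 : ℝ) ≤ 2.45 := Real.sqrt_le_iff.2 (by norm_num)
  -- The constant on the left is below `32`, and `44 ^ 2 = 1936 ≤ 2007`.
  have h3 : (8 * √2 * (3 / 4) + 8 * √6 + 5 * (3 / 4)) * (√(Real.log (6 * T / δ)) * √T) ≤
      √(2007 * T * Real.log (6 * T / δ)) :=
    const_mul_sqrt_mul_sqrt_le (r := 44) (by linarith) hL0 (by norm_num)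
  have hlog2 : 0.6931 < Real.log 2 := by linarith [Real.log_two_gt_d9]
  -- Here `T > 64` enters: it gives `5.8 * log T + 9 ≤ 8 * log T`.
  have hlogT : 6 * Real.log 2 ≤ Real.log T := by
    rw [show (6 : ℝ) = (6 : ℕ) by norm_num, ← Real.log_pow]
    exact Real.log_le_log (by norm_num) (by norm_num; exact_mod_cast hT.le)
  have hdiv : Real.log T / Real.log 2 ≤ 1.45 * Real.log T := by
    rw [div_le_iff₀ (by linarith)]
    nlinarith
  have h4 : g * (4 * (Real.log T / Real.log 2 + 1) + 5) ≤ g * (8 * Real.log T) :=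
    mul_le_mul_of_nonneg_left (by linarith) hg
  have h5 : g * (8 * Real.log T) = 8 * γ * (k + 1) * Real.log T / (1 - γ) := by
    rw [hgdef]; ring
  linarith [Real.sqrt_nonneg (T : ℝ)]

theorem GoodPath.lazyRegret_global_le {μ : ℝ} (hT : 1 ≤ T) (hδ : 0 < δ) (hδ1 : δ < 1)
    (h : GoodPath T (δ / 2) (globalRadius T (δ / 2)) v m (cdf ν) μ) :
    lazyRegret ν T (δ / 2) (globalRadius T (δ / 2)) v m ≤
      √(20783 * T * Real.log (6 * T / δ)) + 32 * √T := by
  have hL0 := log_six_nonneg hT hδ hδ1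
  have hmain := h.lazyRegret_le hT (c := 2) (g := 0) (L := Real.log (6 * T / δ)) le_rfl
    (by norm_num) (by rw [log_div_half]; norm_num) hL0 (fun n hn => by
      have hn0 : (0 : ℝ) < n := by exact_mod_cast hn
      rw [globalRadius, zero_mul, add_zero]
      refine Real.sqrt_le_iff.2 ⟨by positivity, ?_⟩
      rw [mul_pow, mul_pow, Real.sq_sqrt hL0, Real.sq_sqrt (by positivity),
        div_eq_mul_inv _ (n : ℝ)]
      refine mul_le_mul_of_nonneg_right ?_ (by positivity)
      linarith [log_four_le hT hδ])
  have h2 : √(2 : ℝ) ≤ 1.415 := Real.sqrt_le_iff.2 (by norm_num)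
  have h6 : √(6 : ℝ) ≤ 2.45 := Real.sqrt_le_iff.2 (by norm_num)
  -- The constant on the left is below `53`, and `144 ^ 2 = 20736 ≤ 20783`.
  have h3 : (8 * √2 * 2 + 8 * √6 + 5 * 2) * (√(Real.log (6 * T / δ)) * √T) ≤
      √(20783 * T * Real.log (6 * T / δ)) :=
    const_mul_sqrt_mul_sqrt_le (r := 144) (by linarith) hL0 (by norm_num)
  linarith [Real.sqrt_nonneg (T : ℝ)]

end RegretBounds

/-! ### Concentration inequalities -/

section Concentration

variable {Ω : Type u} [mΩ : MeasurableSpace Ω] {P : Measure Ω} [IsProbabilityMeasure P]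

theorem ProbabilityTheory.HasSubgaussianMGF.measure_abs_ge_le {X : Ω → ℝ} {c : NNReal}
    (h : HasSubgaussianMGF X c P) {ε : ℝ} (hε : 0 ≤ ε) :
    P.real {ω | ε ≤ |X ω|} ≤ 2 * Real.exp (-ε ^ 2 / (2 * c)) := by
  have hsub : {ω | ε ≤ |X ω|} ⊆ {ω | ε ≤ X ω} ∪ {ω | ε ≤ (-X) ω} := fun ω hω => by
    simpa [le_abs] using hω
  calc P.real {ω | ε ≤ |X ω|} ≤ P.real {ω | ε ≤ X ω} + P.real {ω | ε ≤ (-X) ω} :=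
        (measureReal_mono hsub).trans (measureReal_union_le _ _)
    _ ≤ _ := by linarith [h.measure_ge_le hε, h.neg.measure_ge_le hε]

/-- Hoeffding's lemma for a Bernoulli variable, read off from the sub-Gaussian bound for the
two-point law `ρ`. -/
theorem one_add_mul_exp_sub_one_le {p : ℝ} (hp : p ∈ Set.Icc (0 : ℝ) 1) (x : ℝ) :
    1 + (Real.exp x - 1) * p ≤ Real.exp (x * p + x ^ 2 / 8) := by
  let ρ : Measure ℝ := ENNReal.ofReal (1 - p) • Measure.dirac 0 + ENNReal.ofReal p • Measure.dirac 1
  have hρ : IsProbabilityMeasure ρ := ⟨by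
    simp only [ρ, Measure.coe_add, Measure.coe_smul, Pi.add_apply, Pi.smul_apply, measure_univ,
      smul_eq_mul, mul_one]
    rw [← ENNReal.ofReal_add (by linarith [hp.2]) hp.1]
    simp⟩
  have hint : ∀ f : ℝ → ℝ, ∫ y, f y ∂ρ = (1 - p) * f 0 + p * f 1 := fun f => by
    rw [integral_add_measure ((integrable_dirac (by simp)).smul_measure (by simp))
      ((integrable_dirac (by simp)).smul_measure (by simp)), integral_smul_measure,
      integral_smul_measure, integral_dirac, integral_dirac, ENNReal.toReal_ofReal hp.1,
      ENNReal.toReal_ofReal (by linarith [hp.2])]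
    rfl
  have hmem : ∀ᵐ y ∂ρ, y ∈ Set.Icc (0 : ℝ) 1 := by
    simp only [ρ, ae_add_measure_iff]
    exact ⟨Measure.ae_smul_measure ((ae_dirac_iff measurableSet_Icc).2 (by simp)) _,
      Measure.ae_smul_measure ((ae_dirac_iff measurableSet_Icc).2 (by simp)) _⟩
  have h := (hasSubgaussianMGF_of_mem_Icc (X := id) aemeasurable_id hmem).mgf_le x
  simp only [mgf, id] at h
  rw [hint fun y => Real.exp (x * (y - ∫ y, y ∂ρ)), hint fun y => y] at h
  have hexp : Real.exp (x * p + x ^ 2 / 8) = Real.exp (x * p) * Real.exp (x ^ 2 / 8) :=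
    Real.exp_add _ _
  have h0 : Real.exp (x * p) * Real.exp (x * (0 - ((1 - p) * 0 + p * 1))) = 1 := by
    rw [← Real.exp_add]; simp
  have h1 : Real.exp (x * p) * Real.exp (x * (1 - ((1 - p) * 0 + p * 1))) = Real.exp x := by
    rw [← Real.exp_add]; congr 1; ring
  have h2 := mul_le_mul_of_nonneg_left h (Real.exp_pos (x * p)).le
  have h3 : (((‖(1 : ℝ) - 0‖₊ / 2) ^ 2 : NNReal) : ℝ) * x ^ 2 / 2 = x ^ 2 / 8 := by
    norm_num; ring
  rw [h3, ← hexp] at h2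
  calc 1 + (Real.exp x - 1) * p = (1 - p) * 1 + p * Real.exp x := by ring
    _ = Real.exp (x * p) * ((1 - p) * Real.exp (x * (0 - ((1 - p) * 0 + p * 1))) +
          p * Real.exp (x * (1 - ((1 - p) * 0 + p * 1)))) := by
        rw [mul_add, mul_left_comm _ (1 - p), mul_left_comm _ p, h0, h1]
    _ ≤ _ := h2

theorem integral_mul_condExp_eq {m : MeasurableSpace Ω} (hm : m ≤ mΩ) {Z X : Ω → ℝ}
    (hZ : StronglyMeasurable[m] Z) (hX : Integrable X P) (hZX : Integrable (Z * X) P) :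
    ∫ ω, Z ω * X ω ∂P = ∫ ω, Z ω * P[X | m] ω ∂P := by
  calc ∫ ω, Z ω * X ω ∂P = ∫ ω, P[Z * X | m] ω ∂P := (integral_condExp hm).symm
    _ = _ := integral_congr_ae (condExp_mul_of_stronglyMeasurable_left hZ hZX hX)

theorem exp_mul_le_of_mem_Icc {x : ℝ} (hx : x ∈ Set.Icc (0 : ℝ) 1) (l : ℝ) :
    Real.exp (l * x) ≤ 1 + (Real.exp l - 1) * x := by
  have := convexOn_exp.2 (Set.mem_univ 0) (Set.mem_univ l) (sub_nonneg.2 hx.2) hx.1 (by ring)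
  simp only [smul_eq_mul, mul_zero, zero_add, Real.exp_zero, mul_one] at this
  rw [mul_comm l x]
  linarith

/-! ### Tail bounds for sums of adapted variables -/

section Adapted

variable {ℱ : Filtration ℕ mΩ} {T : ℕ} {ξ : ℕ → Ω → ℝ} {μ : ℝ}

theorem stronglyMeasurable_sum_Icc (hξ : ∀ s ∈ Set.Icc 1 T, StronglyMeasurable[ℱ s] (ξ s))
    {t : ℕ} (ht : t ≤ T) :
    StronglyMeasurable[ℱ t] fun ω => ∑ s ∈ Finset.Icc 1 t, (ξ s ω - μ) := by
  refine Finset.stronglyMeasurable_fun_sum _ fun s hs => ?_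
  have hs := Finset.mem_Icc.1 hs
  exact ((hξ s ⟨hs.1, hs.2.trans ht⟩).mono (ℱ.mono hs.2)).sub stronglyMeasurable_const

theorem sum_Icc_mem_Icc {P : Measure Ω}
    (h01 : ∀ s ∈ Set.Icc 1 T, ∀ᵐ ω ∂P, ξ s ω ∈ Set.Icc (0 : ℝ) 1)
    {t : ℕ} (ht : t ≤ T) :
    ∀ᵐ ω ∂P, ∑ s ∈ Finset.Icc 1 t, (ξ s ω - μ) ∈ Set.Icc (t * (0 - μ)) (t * (1 - μ)) := by
  filter_upwards [(ae_ball_iff (Set.to_countable (Set.Icc 1 T))).2 h01] with ω hω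
  have hω : ∀ s ∈ Finset.Icc 1 t, ξ s ω ∈ Set.Icc (0 : ℝ) 1 := fun s hs =>
    hω s ⟨(Finset.mem_Icc.1 hs).1, (Finset.mem_Icc.1 hs).2.trans ht⟩
  constructor
  · refine le_trans (by simp) (Finset.card_nsmul_le_sum _ _ (0 - μ) fun s hs => ?_)
    linarith [(hω s hs).1]
  · refine (Finset.sum_le_card_nsmul _ _ (1 - μ) fun s hs => ?_).trans (by simp)
    linarith [(hω s hs).2]

/-- Hoeffding's lemma for sums of adapted `[0,1]`-valued variables with constant conditional
mean. -/
theorem hasSubgaussianMGF_sum_of_condExp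
    (hξ : ∀ s ∈ Set.Icc 1 T, StronglyMeasurable[ℱ s] (ξ s))
    (h01 : ∀ s ∈ Set.Icc 1 T, ∀ᵐ ω ∂P, ξ s ω ∈ Set.Icc (0 : ℝ) 1)
    (hmean : ∀ t < T, P[ξ (t + 1) | ℱ t] =ᵐ[P] fun _ => μ) (hμ : μ ∈ Set.Icc (0 : ℝ) 1) :
    ∀ t ≤ T, HasSubgaussianMGF (fun ω => ∑ s ∈ Finset.Icc 1 t, (ξ s ω - μ)) (t / 4) P := by
  have hint : ∀ t ≤ T, ∀ l : ℝ,
      Integrable (fun ω => Real.exp (l * ∑ s ∈ Finset.Icc 1 t, (ξ s ω - μ))) P := fun t ht l =>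
    integrable_exp_mul_of_mem_Icc
      ((stronglyMeasurable_sum_Icc hξ ht).mono (ℱ.le t)).measurable.aemeasurable
      (sum_Icc_mem_Icc h01 ht)
  intro t ht
  refine ⟨hint t ht, fun l => ?_⟩
  induction t with
  | zero => simp [mgf]
  | succ t ih =>
    have ih := ih (by omega)
    simp only [mgf] at ih ⊢
    set Z : Ω → ℝ := fun ω => Real.exp (l * ∑ s ∈ Finset.Icc 1 t, (ξ s ω - μ)) with hZdef
    have hZm : StronglyMeasurable[ℱ t] Z :=
      Real.continuous_exp.comp_stronglyMeasurable
        ((stronglyMeasurable_sum_Icc hξ (by omega)).const_mul l)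
    have hZi : Integrable Z P := hint t (by omega) l
    have hmem : t + 1 ∈ Set.Icc 1 T := ⟨by omega, ht⟩
    have hXm : AEStronglyMeasurable (ξ (t + 1)) P :=
      ((hξ _ hmem).mono (ℱ.le _)).aestronglyMeasurable
    have hXb : ∀ᵐ ω ∂P, ‖ξ (t + 1) ω‖ ≤ 1 := by
      filter_upwards [h01 _ hmem] with ω hω
      rw [Real.norm_eq_abs, abs_of_nonneg hω.1]
      exact hω.2
    have hXi : Integrable (ξ (t + 1)) P := Integrable.of_bound hXm 1 hXb
    have hZX : Integrable (fun ω => Z ω * ξ (t + 1) ω) P := hZi.mul_bdd hXm hXb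
    have hcond : ∫ ω, Z ω * ξ (t + 1) ω ∂P = (∫ ω, Z ω ∂P) * μ := by
      rw [integral_mul_condExp_eq (ℱ.le t) hZm hXi hZX, ← integral_mul_const]
      refine integral_congr_ae ?_
      filter_upwards [hmean t (by omega)] with ω hω
      rw [hω]
    have hZ0 : 0 ≤ ∫ ω, Z ω ∂P := integral_nonneg fun ω => (Real.exp_pos _).le
    -- The chord bound for `exp` is affine in `ξ (t + 1)`, so only the conditional mean matters, and
    -- the Bernoulli bound applies with `p = μ`.
    calc ∫ ω, Real.exp (l * ∑ s ∈ Finset.Icc 1 (t + 1), (ξ s ω - μ)) ∂P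
        ≤ ∫ ω, Real.exp (-(l * μ)) * (Z ω + (Real.exp l - 1) * (Z ω * ξ (t + 1) ω)) ∂P := by
          refine integral_mono_ae (hint _ ht l)
            ((hZi.add (hZX.const_mul (Real.exp l - 1))).const_mul _) ?_
          filter_upwards [h01 _ hmem] with ω hω
          rw [Finset.sum_Icc_succ_top (by omega), mul_add, Real.exp_add, mul_sub, sub_eq_add_neg,
            Real.exp_add]
          have h := mul_le_mul_of_nonneg_left (exp_mul_le_of_mem_Icc hω l)
            (mul_nonneg (Real.exp_pos (l * ∑ s ∈ Finset.Icc 1 t, (ξ s ω - μ))).le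
              (Real.exp_pos (-(l * μ))).le)
          simp only [hZdef]
          linarith
      _ = Real.exp (-(l * μ)) * (∫ ω, Z ω ∂P) * (1 + (Real.exp l - 1) * μ) := by
          rw [integral_const_mul, integral_add hZi (hZX.const_mul _), integral_const_mul, hcond]
          ring
      _ ≤ Real.exp (-(l * μ)) * Real.exp ((t / 4 : NNReal) * l ^ 2 / 2) *
            Real.exp (l * μ + l ^ 2 / 8) := by
          refine mul_le_mul (mul_le_mul_of_nonneg_left ih (Real.exp_pos _).le)
            (one_add_mul_exp_sub_one_le hμ l) ?_ (by positivity)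
          linarith [hμ.2, mul_nonneg (Real.exp_pos l).le hμ.1]
      _ = _ := by
          rw [← Real.exp_add, ← Real.exp_add]
          congr 1
          push_cast
          ring

/-- Chord bounds for `exp (l * y)` and `exp (-l * y)`. The result is affine in `y`, with a slope
that has the sign of `x` when `l ≥ 0`. -/
theorem cosh_add_mul_le {x y l : ℝ} (hy : |y| ≤ 1) :
    Real.cosh (x + l * y) ≤ Real.cosh x * Real.cosh l + Real.sinh l * (Real.sinh x * y) := by
  have hy := abs_le.1 hy
  have h : ∀ l : ℝ, Real.exp (l * y) ≤ Real.cosh l + y * Real.sinh l := by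
    intro l
    have := convexOn_exp.2 (Set.mem_univ (-l)) (Set.mem_univ l)
      (show 0 ≤ (1 - y) / 2 by linarith) (show 0 ≤ (1 + y) / 2 by linarith) (by ring)
    simp only [smul_eq_mul] at this
    rw [Real.cosh_eq, Real.sinh_eq]
    rw [show (1 - y) / 2 * -l + (1 + y) / 2 * l = l * y by ring] at this
    linarith
  have h1 := h l
  have h2 := h (-l)
  rw [Real.cosh_neg, Real.sinh_neg, neg_mul] at h2
  rw [Real.cosh_eq (x + l * y), neg_add, Real.exp_add, Real.exp_add]
  have h3 := mul_le_mul_of_nonneg_left h1 (Real.exp_pos x).le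
  have h4 := mul_le_mul_of_nonneg_left h2 (Real.exp_pos (-x)).le
  rw [Real.cosh_eq x, Real.sinh_eq x]
  linarith

theorem sinh_mul_nonpos {x c l : ℝ} (hl : 0 ≤ l) (h : c * x ≤ 0) : Real.sinh (l * x) * c ≤ 0 := by
  rcases lt_trichotomy x 0 with hx | rfl | hx
  · exact mul_nonpos_of_nonpos_of_nonneg
      (Real.sinh_nonpos_iff.2 (mul_nonpos_of_nonneg_of_nonpos hl hx.le)) (by nlinarith)
  · simp
  · exact mul_nonpos_of_nonneg_of_nonpos (Real.sinh_nonneg_iff.2 (by positivity)) (by nlinarith)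

/-- Only the sign of the drift is known, so an even function replaces `exp`. The cross term with
`sinh` has nonpositive mean, and each step costs `cosh l ≤ exp (l ^ 2 / 2)`. -/
theorem integral_cosh_sum_le (hξ : ∀ s ∈ Set.Icc 1 T, StronglyMeasurable[ℱ s] (ξ s))
    (h01 : ∀ s ∈ Set.Icc 1 T, ∀ᵐ ω ∂P, ξ s ω ∈ Set.Icc (0 : ℝ) 1)
    (hrev : GlobalMeanReversion P ℱ T μ ξ) (hμ : μ ∈ Set.Icc (0 : ℝ) 1) {l : ℝ} (hl : 0 ≤ l) :
    ∀ t ≤ T, Integrable (fun ω => Real.cosh (l * ∑ s ∈ Finset.Icc 1 t, (ξ s ω - μ))) P ∧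
      ∫ ω, Real.cosh (l * ∑ s ∈ Finset.Icc 1 t, (ξ s ω - μ)) ∂P ≤
        Real.exp (t * (l ^ 2 / 2)) := by
  have hexp : ∀ t ≤ T, ∀ l : ℝ,
      Integrable (fun ω => Real.exp (l * ∑ s ∈ Finset.Icc 1 t, (ξ s ω - μ))) P := fun t ht l =>
    integrable_exp_mul_of_mem_Icc
      ((stronglyMeasurable_sum_Icc hξ ht).mono (ℱ.le t)).measurable.aemeasurable
      (sum_Icc_mem_Icc h01 ht)
  have hcosh : ∀ t ≤ T,
      Integrable (fun ω => Real.cosh (l * ∑ s ∈ Finset.Icc 1 t, (ξ s ω - μ))) P := fun t ht => by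
    simp only [Real.cosh_eq, ← neg_mul]
    exact ((hexp t ht l).add (hexp t ht (-l))).div_const 2
  have hsinh : ∀ t ≤ T,
      Integrable (fun ω => Real.sinh (l * ∑ s ∈ Finset.Icc 1 t, (ξ s ω - μ))) P := fun t ht => by
    simp only [Real.sinh_eq, ← neg_mul]
    exact ((hexp t ht l).sub (hexp t ht (-l))).div_const 2
  intro t ht
  refine ⟨hcosh t ht, ?_⟩
  induction t with
  | zero => simp
  | succ t ih =>
    have ih := ih (by omega)
    have hmem : t + 1 ∈ Set.Icc 1 T := ⟨by omega, ht⟩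
    set X : Ω → ℝ := fun ω => ξ (t + 1) ω - μ with hXdef
    set Z : Ω → ℝ := fun ω => Real.sinh (l * ∑ s ∈ Finset.Icc 1 t, (ξ s ω - μ)) with hZdef
    have hXm : AEStronglyMeasurable X P :=
      (((hξ _ hmem).mono (ℱ.le _)).sub stronglyMeasurable_const).aestronglyMeasurable
    have hXb : ∀ᵐ ω ∂P, ‖X ω‖ ≤ 1 := by
      filter_upwards [h01 _ hmem] with ω hω
      rw [Real.norm_eq_abs, abs_le]
      exact ⟨by linarith [hω.1, hμ.2], by linarith [hω.2, hμ.1]⟩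
    have hXi : Integrable X P := Integrable.of_bound hXm 1 hXb
    have hZX : Integrable (fun ω => Z ω * X ω) P := (hsinh t (by omega)).mul_bdd hXm hXb
    have hZm : StronglyMeasurable[ℱ t] Z :=
      Real.continuous_sinh.comp_stronglyMeasurable
        ((stronglyMeasurable_sum_Icc hξ (by omega)).const_mul l)
    have hcross : ∫ ω, Z ω * X ω ∂P ≤ 0 := by
      rw [integral_mul_condExp_eq (ℱ.le t) hZm hXi hZX]
      refine integral_nonpos_of_ae ?_
      -- Mean reversion is assumed only from `t = 1` on. At `t = 0` the sum is empty and `sinh 0 =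
      -- 0`.
      rcases Nat.eq_zero_or_pos t with rfl | h0
      · exact Filter.Eventually.of_forall fun ω => by simp [hZdef]
      · filter_upwards [hrev t h0 (by omega)] with ω hω
        exact sinh_mul_nonpos hl hω
    calc ∫ ω, Real.cosh (l * ∑ s ∈ Finset.Icc 1 (t + 1), (ξ s ω - μ)) ∂P
        ≤ ∫ ω, (Real.cosh (l * ∑ s ∈ Finset.Icc 1 t, (ξ s ω - μ)) * Real.cosh l +
            Real.sinh l * (Z ω * X ω)) ∂P := by
          refine integral_mono_ae (hcosh _ ht)
            (((hcosh t (by omega)).mul_const _).add (hZX.const_mul _)) ?_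
          filter_upwards [hXb] with ω hω
          rw [Finset.sum_Icc_succ_top (by omega), mul_add]
          exact cosh_add_mul_le hω
      _ = (∫ ω, Real.cosh (l * ∑ s ∈ Finset.Icc 1 t, (ξ s ω - μ)) ∂P) * Real.cosh l +
            Real.sinh l * ∫ ω, Z ω * X ω ∂P := by
          rw [integral_add ((hcosh t (by omega)).mul_const _) (hZX.const_mul _),
            integral_mul_const, integral_const_mul]
      _ ≤ Real.exp (t * (l ^ 2 / 2)) * Real.exp (l ^ 2 / 2) + 0 := by
          refine add_le_add (mul_le_mul ih (Real.cosh_le_exp_half_sq l) (Real.cosh_pos l).le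
            (Real.exp_pos _).le) ?_
          exact mul_nonpos_of_nonneg_of_nonpos (Real.sinh_nonneg_iff.2 hl) hcross
      _ = _ := by
          rw [add_zero, ← Real.exp_add]
          congr 1
          push_cast
          ring

theorem GlobalMeanReversion.measure_abs_ge_le
    (hξ : ∀ s ∈ Set.Icc 1 T, StronglyMeasurable[ℱ s] (ξ s))
    (h01 : ∀ s ∈ Set.Icc 1 T, ∀ᵐ ω ∂P, ξ s ω ∈ Set.Icc (0 : ℝ) 1)
    (hrev : GlobalMeanReversion P ℱ T μ ξ) (hμ : μ ∈ Set.Icc (0 : ℝ) 1) {t : ℕ}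
    (ht1 : 1 ≤ t) (ht : t ≤ T) {ε : ℝ} (hε : 0 ≤ ε) :
    P.real {ω | ε ≤ |∑ s ∈ Finset.Icc 1 t, (ξ s ω - μ)|} ≤
      2 * Real.exp (-ε ^ 2 / (2 * t)) := by
  have ht0 : (0 : ℝ) < t := by exact_mod_cast ht1
  -- Minimizes the exponent `t * l ^ 2 / 2 - l * ε` in Markov's inequality. The factor `2` comes
  -- from `exp |x| / 2 ≤ cosh x`.
  set l := ε / t
  have hl : 0 ≤ l := by positivity
  obtain ⟨hi, hle⟩ := integral_cosh_sum_le hξ h01 hrev hμ hl t ht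
  have hmarkov := mul_meas_ge_le_integral_of_nonneg
    (Filter.Eventually.of_forall fun ω => (Real.cosh_pos _).le) hi (Real.exp (l * ε) / 2)
  have hsub : {ω | ε ≤ |∑ s ∈ Finset.Icc 1 t, (ξ s ω - μ)|} ⊆
      {ω | Real.exp (l * ε) / 2 ≤ Real.cosh (l * ∑ s ∈ Finset.Icc 1 t, (ξ s ω - μ))} := by
    intro ω hω
    simp only [Set.mem_ofPred_eq] at hω ⊢
    rw [← Real.cosh_abs, abs_mul, abs_of_nonneg hl, Real.cosh_eq]
    have h1 := Real.exp_le_exp.2 (mul_le_mul_of_nonneg_left hω hl)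
    have h2 := Real.exp_pos (-(l * |∑ s ∈ Finset.Icc 1 t, (ξ s ω - μ)|))
    linarith
  have h1 : Real.exp (l * ε) / 2 * P.real {ω | ε ≤ |∑ s ∈ Finset.Icc 1 t, (ξ s ω - μ)|} ≤
      Real.exp (t * (l ^ 2 / 2)) :=
    (mul_le_mul_of_nonneg_left (measureReal_mono hsub) (by positivity)).trans (hmarkov.trans hle)
  have h2 : Real.exp (t * (l ^ 2 / 2)) = Real.exp (l * ε) * Real.exp (-ε ^ 2 / (2 * t)) := by
    rw [← Real.exp_add]
    congr 1
    simp only [l]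
    field_simp
    ring
  rw [h2] at h1
  have h3 := Real.exp_pos (l * ε)
  refine le_of_mul_le_mul_left ?_ h3
  linarith

end Adapted

end Concentration

/-! ### Confidence of the estimates -/

section FailureEvents

variable {Ω : Type u} {ν : Measure ℝ} {T : ℕ} {V : ℕ → Ω → ℝ}

/-- The event that some empirical c.d.f. leaves its confidence band at a grid price. -/
def cdfFailure (ν : Measure ℝ) (T : ℕ) (δ : ℝ) (V : ℕ → Ω → ℝ) : Set Ω :=
  ⋃ t ∈ Finset.Icc 1 T, ⋃ x ∈ priceGrid T,
    {ω | t * cdfRadius T δ t ≤ |valuationCount (fun s => V s ω) t x - t * cdf ν x|}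

/-- The event that the sum of the deviations of `ξ` from `μ` reaches `t * ρ t` for some `t`. -/
def meanFailure (T : ℕ) (ρ : ℕ → ℝ) (ξ : ℕ → Ω → ℝ) (μ : ℝ) : Set Ω :=
  ⋃ t ∈ Finset.Icc 1 T, {ω | t * ρ t ≤ |∑ s ∈ Finset.Icc 1 t, (ξ s ω - μ)|}

theorem abs_count_div_sub_le {v : ℕ → ℝ} {t : ℕ} (ht : 1 ≤ t) {x y r : ℝ}
    (h : |valuationCount v t x - t * y| < t * r) : |valuationCount v t x / t - y| ≤ r := by
  have ht0 : (0 : ℝ) < t := by exact_mod_cast ht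
  have : valuationCount v t x - t * y = t * (valuationCount v t x / t - y) := by
    field_simp
  rw [this, abs_mul, abs_of_pos ht0] at h
  exact (lt_of_mul_lt_mul_left h ht0.le).le

theorem goodPath_of_notMem_cdfFailure {ω : Ω} {δ μ : ℝ} {φ : ℕ → ℝ} {m : ℕ → ℝ}
    (hμ : μ ∈ Set.Icc (0 : ℝ) 1) (hω : ω ∉ cdfFailure ν T δ V)
    (hm : ∀ t, 1 ≤ t → t ≤ T → |(∑ s ∈ Finset.Icc 1 t, m s) / t - μ| ≤ φ t) :
    GoodPath T δ φ (fun t => V t ω) m (cdf ν) μ where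
  mono := monotone_cdf ν
  nonneg := cdf_nonneg ν
  le_one := cdf_le_one ν
  mean_nonneg := hμ.1
  mean_le_one := hμ.2
  cdf_close := fun t h1 h2 x hx => by
    simp only [cdfFailure, Set.mem_iUnion, not_exists] at hω
    exact abs_count_div_sub_le h1 (not_le.1 (hω t (Finset.mem_Icc.2 ⟨h1, h2⟩) x hx))
  mean_close := hm

theorem lt_of_notMem_meanFailure {ω : Ω} {ξ : ℕ → Ω → ℝ} {μ : ℝ} {ρ : ℕ → ℝ}
    (hω : ω ∉ meanFailure T ρ ξ μ) {t : ℕ} (ht1 : 1 ≤ t) (ht : t ≤ T) :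
    |∑ s ∈ Finset.Icc 1 t, (ξ s ω - μ)| < t * ρ t := by
  simp only [meanFailure, Set.mem_iUnion, not_exists] at hω
  exact not_le.1 (hω t (Finset.mem_Icc.2 ⟨ht1, ht⟩))

end FailureEvents

/-! ### Prices as noise up to boundary terms -/

section PricePaths

variable {Ω : Type u} {T k : ℕ} {g : Fin k → ℝ} {μ : ℝ} {M : ℤ → Ω → ℝ}

theorem abs_sum_div_sub_le {m : ℕ → ℝ} {t : ℕ} (ht : 1 ≤ t) {μ r : ℝ}
    (h : |∑ s ∈ Finset.Icc 1 t, (m s - μ)| ≤ t * r) :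
    |(∑ s ∈ Finset.Icc 1 t, m s) / t - μ| ≤ r := by
  have ht0 : (0 : ℝ) < t := by exact_mod_cast ht
  have : ∑ s ∈ Finset.Icc 1 t, (m s - μ) = t * ((∑ s ∈ Finset.Icc 1 t, m s) / t - μ) := by
    rw [Finset.sum_sub_distrib, mul_sub, mul_div_cancel₀ _ ht0.ne']
    simp
  rw [this, abs_mul, abs_of_pos ht0] at h
  exact le_of_mul_le_mul_left h ht0

/-- The noise recovered from the prices. -/
def recoveredNoise {k : ℕ} (g : Fin k → ℝ) (M : ℤ → Ω → ℝ) (s : ℕ) (ω : Ω) : ℝ :=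
  (M s ω - ∑ τ : Fin k, g τ * M ((s : ℤ) - 1 - (τ : ℕ)) ω) / (1 - ∑ τ, g τ)

/-- One more lag moves the window by one step: one price enters and one leaves, so the sum of
`[0,1]`-valued prices changes by at most `1`. -/
theorem sum_shift_succ_sub (m : ℤ → ℝ) (t j : ℕ) :
    ∑ s ∈ Finset.Icc 1 t, m ((s : ℤ) - (j + 1 : ℕ)) - ∑ s ∈ Finset.Icc 1 t, m ((s : ℤ) - j) =
      m (-(j : ℤ)) - m ((t : ℤ) - j) := by
  induction t with
  | zero => simp
  | succ t ih =>
    rw [Finset.sum_Icc_succ_top (by omega), Finset.sum_Icc_succ_top (by omega),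
      show ((t + 1 : ℕ) : ℤ) - (j + 1 : ℕ) = t - j by push_cast; ring]
    linarith

theorem abs_sum_shift_sub_le {m : ℤ → ℝ} (hm : ∀ j : ℤ, -(k : ℤ) < j → j ≤ T →
    m j ∈ Set.Icc (0 : ℝ) 1) {t : ℕ} (ht : t ≤ T) {j : ℕ} (hj : j ≤ k) :
    |∑ s ∈ Finset.Icc 1 t, m ((s : ℤ) - j) - ∑ s ∈ Finset.Icc 1 t, m s| ≤ j := by
  induction j with
  | zero => simp
  | succ j ih =>
    have ih := ih (by omega)
    have htel := sum_shift_succ_sub m t j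
    have h1 := hm (-(j : ℤ)) (by omega) (by omega)
    have h2 := hm ((t : ℤ) - j) (by omega) (by omega)
    rw [abs_le] at ih ⊢
    push_cast at *
    constructor <;> linarith [h1.1, h1.2, h2.1, h2.2]

/-- The prices and the noise have nearly the same sums. -/
theorem abs_sum_sub_sum_recoveredNoise_le {ω : Ω} (hg : ∀ τ, 0 ≤ g τ) (hg1 : ∑ τ, g τ < 1)
    (hm : ∀ j : ℤ, -(k : ℤ) < j → j ≤ T → M j ω ∈ Set.Icc (0 : ℝ) 1) {t : ℕ} (ht : t ≤ T) :
    |∑ s ∈ Finset.Icc 1 t, M s ω - ∑ s ∈ Finset.Icc 1 t, recoveredNoise g M s ω| ≤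
      (∑ τ, g τ) * (k + 1) / (1 - ∑ τ, g τ) := by
  have hpos : 0 < 1 - ∑ τ, g τ := by linarith
  have hnoise : ∀ s : ℕ, (1 - ∑ τ, g τ) * recoveredNoise g M s ω =
      M s ω - ∑ τ : Fin k, g τ * M ((s : ℤ) - ((τ : ℕ) + 1 : ℕ)) ω := fun s => by
    rw [recoveredNoise, mul_div_cancel₀ _ hpos.ne']
    simp only [Nat.cast_add, Nat.cast_one, sub_sub, add_comm]
  -- Summing the recursion leaves only differences between lagged and unlagged sums, which are
  -- boundary terms.
  have hdiff : (1 - ∑ τ, g τ) * (∑ s ∈ Finset.Icc 1 t, M s ω -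
      ∑ s ∈ Finset.Icc 1 t, recoveredNoise g M s ω) =
      ∑ τ : Fin k, g τ * (∑ s ∈ Finset.Icc 1 t, M ((s : ℤ) - ((τ : ℕ) + 1 : ℕ)) ω -
        ∑ s ∈ Finset.Icc 1 t, M s ω) := by
    simp only [mul_sub, Finset.sum_sub_distrib, Finset.mul_sum (Finset.Icc 1 t)]
    rw [Finset.sum_congr rfl fun s _ => hnoise s, Finset.sum_sub_distrib,
      Finset.sum_comm (t := Finset.Icc 1 t), Finset.sum_comm (t := Finset.Icc 1 t)]
    simp only [← Finset.sum_mul, sub_mul, one_mul, Finset.sum_sub_distrib]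
    ring
  have hle : |(1 - ∑ τ, g τ) * (∑ s ∈ Finset.Icc 1 t, M s ω -
      ∑ s ∈ Finset.Icc 1 t, recoveredNoise g M s ω)| ≤ (∑ τ, g τ) * (k + 1) := by
    rw [hdiff, Finset.sum_mul]
    refine (Finset.abs_sum_le_sum_abs _ _).trans (Finset.sum_le_sum fun τ _ => ?_)
    rw [abs_mul, abs_of_nonneg (hg τ)]
    refine mul_le_mul_of_nonneg_left ?_ (hg τ)
    refine (abs_sum_shift_sub_le (m := fun j => M j ω) hm ht τ.2).trans ?_
    have : (τ : ℕ) + 1 ≤ k + 1 := by omega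
    exact_mod_cast this
  rw [abs_mul, abs_of_pos hpos] at hle
  rw [le_div_iff₀ hpos]
  linarith

theorem mean_close_of_notMem_meanFailure {ω : Ω} {δ : ℝ} (hg : ∀ τ, 0 ≤ g τ)
    (hg1 : ∑ τ, g τ < 1)
    (hm : ∀ j : ℤ, -(k : ℤ) < j → j ≤ T → M j ω ∈ Set.Icc (0 : ℝ) 1)
    (hω : ω ∉ meanFailure T (fun t => √(Real.log (2 * T / δ) / (2 * t))) (recoveredNoise g M) μ)
    {t : ℕ} (ht1 : 1 ≤ t) (ht : t ≤ T) :
    |(∑ s ∈ Finset.Icc 1 t, M s ω) / t - μ| ≤ localRadius T δ (∑ τ, g τ) k t := by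
  have ht0 : (0 : ℝ) < t := by exact_mod_cast ht1
  refine abs_sum_div_sub_le ht1 ?_
  have h1 := lt_of_notMem_meanFailure hω ht1 ht
  have h2 := abs_sum_sub_sum_recoveredNoise_le hg hg1 hm ht
  have h3 : ∑ s ∈ Finset.Icc 1 t, (M s ω - μ) =
      ∑ s ∈ Finset.Icc 1 t, (recoveredNoise g M s ω - μ) +
        (∑ s ∈ Finset.Icc 1 t, M s ω - ∑ s ∈ Finset.Icc 1 t, recoveredNoise g M s ω) := by
    simp only [Finset.sum_sub_distrib]
    ring
  have h4 : (t : ℝ) * localRadius T δ (∑ τ, g τ) k t =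
      t * √(Real.log (2 * T / δ) / (2 * t)) + (∑ τ, g τ) * (k + 1) / (1 - ∑ τ, g τ) := by
    have : 1 - ∑ τ, g τ ≠ 0 := by linarith
    rw [localRadius, mul_add]
    congr 1
    field_simp
  rw [h3, h4]
  exact (abs_add_le _ _).trans (add_le_add h1.le h2)

end PricePaths

/-! ### Probability of the failure events -/

section Confidence

variable {Ω : Type u} [mΩ : MeasurableSpace Ω] {P : Measure Ω}
  {ν : Measure ℝ} {T : ℕ} {V : ℕ → Ω → ℝ}

theorem StochasticValuations.hasSubgaussianMGF_indicator [IsProbabilityMeasure P] [IsProbabilityMeasure ν]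
    (hV : StochasticValuations P ν T V) {t : ℕ} (ht : t ∈ Set.Icc 1 T) (x : ℝ) :
    HasSubgaussianMGF (fun ω => (if V t ω ≤ x then 1 else 0) - cdf ν x) (1 / 4) P := by
  have hmeas : Measurable fun ω => if V t ω ≤ x then (1 : ℝ) else 0 :=
    Measurable.ite (measurableSet_le (hV.measurable t ht) measurable_const) measurable_const
      measurable_const
  have hmean : ∫ ω, (if V t ω ≤ x then (1 : ℝ) else 0) ∂P = cdf ν x := by
    have : (fun ω => if V t ω ≤ x then (1 : ℝ) else 0) =
        (V t ⁻¹' Set.Iic x).indicator 1 := by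
      ext ω
      simp [Set.indicator]
    rw [this, integral_indicator_one (hV.measurable t ht measurableSet_Iic), cdf_eq_real,
      ← hV.law t ht, map_measureReal_apply (hV.measurable t ht) measurableSet_Iic]
  have h := hasSubgaussianMGF_of_mem_Icc (a := 0) (b := 1) (μ := P) hmeas.aemeasurable
    (Filter.Eventually.of_forall fun ω => by split_ifs <;> simp)
  rw [hmean] at h
  convert h using 1
  ext
  norm_num

theorem StochasticValuations.measure_abs_count_ge_le [IsProbabilityMeasure P] [IsProbabilityMeasure ν]
    (hV : StochasticValuations P ν T V) {t : ℕ} (ht : t ∈ Set.Icc 1 T) (x : ℝ) {ε : ℝ}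
    (hε : 0 ≤ ε) :
    P.real {ω | t * ε ≤ |valuationCount (fun s => V s ω) t x - t * cdf ν x|} ≤
      2 * Real.exp (-(2 * t * ε ^ 2)) := by
  have ht0 : (0 : ℝ) < t := by exact_mod_cast ht.1
  have hind := hV.indep.comp (fun _ y => (if y ≤ x then (1 : ℝ) else 0) - cdf ν x)
    (fun _ => (Measurable.ite measurableSet_Iic measurable_const measurable_const).sub_const _)
  have h := HasSubgaussianMGF.sum_of_iIndepFun hind (c := fun _ => 1 / 4)
    (s := (Finset.Icc 1 t).subtype (· ∈ Set.Icc 1 T))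
    (fun i _ => hV.hasSubgaussianMGF_indicator i.2 x)
  have hmem : ∀ s ∈ Finset.Icc 1 t, s ∈ Set.Icc 1 T := fun s hs =>
    ⟨(Finset.mem_Icc.1 hs).1, (Finset.mem_Icc.1 hs).2.trans ht.2⟩
  have hsum : ∀ ω, ∑ i ∈ (Finset.Icc 1 t).subtype (· ∈ Set.Icc 1 T),
      ((fun y => (if y ≤ x then (1 : ℝ) else 0) - cdf ν x) ∘ V i) ω =
      valuationCount (fun s => V s ω) t x - t * cdf ν x := fun ω => by
    rw [Finset.sum_subtype_of_mem
      (fun i => ((fun y => (if y ≤ x then (1 : ℝ) else 0) - cdf ν x) ∘ V i) ω) hmem]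
    simp [valuationCount]
  have hcard : ∑ _i ∈ (Finset.Icc 1 t).subtype (· ∈ Set.Icc 1 T), (1 / 4 : NNReal) = t / 4 := by
    rw [Finset.sum_subtype_of_mem (fun _ => (1 / 4 : NNReal)) hmem]
    simp [div_eq_mul_inv]
  simp only [hsum, hcard] at h
  refine (h.measure_abs_ge_le (mul_nonneg ht0.le hε)).trans (le_of_eq ?_)
  congr 2
  push_cast
  field_simp
  ring

theorem card_priceGrid_le (T : ℕ) : ((priceGrid T).card : ℝ) ≤ √T + 2 := by
  have h1 : (priceGrid T).card ≤ ⌈√(T : ℝ)⌉₊ + 1 := by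
    unfold priceGrid
    simpa using Finset.card_image_le (s := Finset.range (⌈√(T : ℝ)⌉₊ + 1))
      (f := fun n : ℕ => (n : ℝ) / (⌈√(T : ℝ)⌉₊ : ℝ))
  have h2 := (Nat.ceil_lt_add_one (Real.sqrt_nonneg (T : ℝ))).le
  have h3 : ((priceGrid T).card : ℝ) ≤ (⌈√(T : ℝ)⌉₊ : ℝ) + 1 := by exact_mod_cast h1
  linarith

/-- The factor `3 / 4` in the radius yields `2 * (δ / (3 * T)) ^ (3 / 2)` per round and grid price,
which pays for `T` rounds and at most `√T + 2 ≤ 3 * √T` prices. The assumption `δ ≤ 1 / 2` gives `q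
* √T = √(δ / 3) ≤ 1 / 2`. -/
theorem StochasticValuations.measure_cdfFailure_le [IsProbabilityMeasure P] [IsProbabilityMeasure ν]
    (hV : StochasticValuations P ν T V) (hT : 1 ≤ T) {δ : ℝ} (hδ : 0 < δ) (hδ1 : δ ≤ 1 / 2) :
    P.real (cdfFailure ν T δ V) ≤ δ := by
  have hT' : (1 : ℝ) ≤ T := by exact_mod_cast hT
  set L := Real.log (3 * T / δ) with hL
  have hL0 : 0 ≤ L := Real.log_nonneg ((one_le_div hδ).2 (by linarith))
  have hexpL : Real.exp (-L) = δ / (3 * T) := by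
    rw [Real.exp_neg, hL, Real.exp_log (by positivity), inv_div]
  set q := Real.exp (-(L / 2)) with hq
  have hq0 : 0 < q := Real.exp_pos _
  have hqq : q * q = δ / (3 * T) := by
    rw [hq, ← Real.exp_add, ← hexpL]
    congr 1
    ring
  have hterm : ∀ t ∈ Finset.Icc 1 T, ∀ x ∈ priceGrid T,
      P.real {ω | t * cdfRadius T δ t ≤ |valuationCount (fun s => V s ω) t x - t * cdf ν x|} ≤
        2 * (δ / (3 * T) * q) := by
    intro t ht x _
    have ht' := Finset.mem_Icc.1 ht
    have ht0 : (0 : ℝ) < t := by exact_mod_cast ht'.1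
    refine (hV.measure_abs_count_ge_le ht' x (Real.sqrt_nonneg _)).trans (le_of_eq ?_)
    rw [Real.sq_sqrt (by positivity), ← hL, ← hexpL, hq, ← Real.exp_add]
    congr 2
    field_simp
    ring
  have hunion : P.real (cdfFailure ν T δ V) ≤
      T * ((priceGrid T).card * (2 * (δ / (3 * T) * q))) := by
    refine (measureReal_biUnion_finset_le _ _).trans ?_
    refine (Finset.sum_le_card_nsmul _ _ _ fun t ht =>
      (measureReal_biUnion_finset_le _ _).trans
        (Finset.sum_le_card_nsmul _ _ _ (hterm t ht))).trans ?_
    simp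
  have hs1 : 1 ≤ √(T : ℝ) := Real.one_le_sqrt.2 hT'
  have hsq := Real.mul_self_sqrt (Nat.cast_nonneg (α := ℝ) T)
  have hqs : q * √T ≤ 1 / 2 := by
    have : (q * √T) ^ 2 ≤ (1 / 2) ^ 2 := by
      have : (q * √T) ^ 2 = δ / 3 := by
        calc (q * √T) ^ 2 = (q * q) * (√T * √T) := by ring
          _ = _ := by rw [hqq, hsq]; field_simp
      rw [this]; linarith
    exact le_of_sq_le_sq this (by norm_num)
  have hT0 : (T : ℝ) ≠ 0 := by positivity
  calc P.real (cdfFailure ν T δ V) ≤ T * ((priceGrid T).card * (2 * (δ / (3 * T) * q))) := hunion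
    _ = 2 / 3 * δ * ((priceGrid T).card * q) := by field_simp
    _ ≤ 2 / 3 * δ * (3 / 2) := by
        refine mul_le_mul_of_nonneg_left ?_ (by positivity)
        have h1 := mul_le_mul_of_nonneg_right (card_priceGrid_le T) hq0.le
        nlinarith [mul_le_mul_of_nonneg_left hs1 hq0.le]
    _ = δ := by ring

theorem measure_meanFailure_le {ξ : ℕ → Ω → ℝ} {μ δ : ℝ} {ρ : ℕ → ℝ} (hδ : 0 < δ)
    (hT : 1 ≤ T)
    (h : ∀ t ∈ Set.Icc 1 T, P.real {ω | t * ρ t ≤ |∑ s ∈ Finset.Icc 1 t, (ξ s ω - μ)|} ≤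
      2 * Real.exp (-Real.log (2 * T / δ))) :
    P.real (meanFailure T ρ ξ μ) ≤ δ := by
  have hT0 : (0 : ℝ) < T := by exact_mod_cast hT
  refine (measureReal_biUnion_finset_le _ _).trans ((Finset.sum_le_card_nsmul _ _ _ fun t ht =>
    h t (Finset.mem_Icc.1 ht)).trans (le_of_eq ?_))
  rw [Real.exp_neg, Real.exp_log (by positivity)]
  simp
  field_simp

/-- If `A` is almost surely contained in two events of probability at most `δ / 2`, then it has
probability at most `δ`. -/
theorem measure_le_of_ae_mem_union [IsProbabilityMeasure P] {A B B' : Set Ω} {δ : ℝ}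
    (hA : ∀ᵐ ω ∂P, ω ∉ B → ω ∉ B' → ω ∉ A) (hB : P.real B ≤ δ / 2) (hB' : P.real B' ≤ δ / 2) :
    P A ≤ ENNReal.ofReal δ := by
  have hsub : A ≤ᵐ[P] (B ∪ B' : Set Ω) := by
    filter_upwards [hA] with ω hω hωA
    by_contra hn
    exact hω (fun h => hn (Or.inl h)) (fun h => hn (Or.inr h)) hωA
  calc P A ≤ P (B ∪ B') := measure_mono_ae hsub
    _ = ENNReal.ofReal (P.real (B ∪ B')) := (ofReal_measureReal).symm
    _ ≤ _ := ENNReal.ofReal_le_ofReal ((measureReal_union_le _ _).trans (by linarith))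

/-! ### Global mean reversion -/

/-- With `μ` outside `[0,1]`, the deviation of `M 1` and the conditional deviation of `M 2` would
have the same strict sign. For `T = 1` the mean-reversion condition is empty, hence `T ≥ 2`. -/
theorem GlobalMeanReversion.mean_mem_Icc [IsProbabilityMeasure P] {ℱ : Filtration ℕ mΩ} {μ : ℝ} {M : ℕ → Ω → ℝ}
    (hrev : GlobalMeanReversion P ℱ T μ M) (hM : BoundedPrices P ℱ T M) (hT : 2 ≤ T) :
    μ ∈ Set.Icc (0 : ℝ) 1 := by
  have h1 : 1 ∈ Set.Icc 1 T := ⟨le_rfl, by omega⟩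
  have h2 : 2 ∈ Set.Icc 1 T := ⟨by omega, hT⟩
  have hr := hrev 1 le_rfl (by omega)
  have hM2 : AEStronglyMeasurable (M 2) P := ((hM.adapted 2 h2).mono (ℱ.le 2)).aestronglyMeasurable
  have hi : Integrable (fun ω => M 2 ω - μ) P := by
    refine (Integrable.of_bound hM2 1 ?_).sub (integrable_const μ)
    filter_upwards [hM.mem_Icc 2 h2] with ω hω
    rw [Real.norm_eq_abs, abs_of_nonneg hω.1]
    exact hω.2
  have hlow := condExp_mono (m := ℱ 1) (integrable_const (0 - μ)) hi (by
    filter_upwards [hM.mem_Icc 2 h2] with ω hω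
    linarith [hω.1])
  have hup := condExp_mono (m := ℱ 1) hi (integrable_const (1 - μ)) (by
    filter_upwards [hM.mem_Icc 2 h2] with ω hω
    linarith [hω.2])
  rw [condExp_const (ℱ.le 1)] at hlow hup
  obtain ⟨ω, hω1, hω, hl, hu⟩ := ((hM.mem_Icc 1 h1).and (hr.and (hlow.and hup))).exists
  simp only [Finset.Icc_self, Finset.sum_singleton] at hω
  norm_num at hω
  constructor
  · by_contra! hneg
    have := mul_pos (show (0 : ℝ) < 0 - μ by linarith) (show 0 < M 1 ω - μ by linarith [hω1.1])
    have := mul_le_mul_of_nonneg_right hl (show 0 ≤ M 1 ω - μ by linarith [hω1.1])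
    linarith
  · by_contra! hneg
    have := mul_pos (show (0 : ℝ) < μ - 1 by linarith) (show 0 < μ - M 1 ω by linarith [hω1.2])
    have := mul_le_mul_of_nonneg_right hu (show 0 ≤ μ - M 1 ω by linarith [hω1.2])
    linarith

theorem GlobalMeanReversion.measure_meanFailure_le [IsProbabilityMeasure P] {ℱ : Filtration ℕ mΩ} {μ : ℝ} {M : ℕ → Ω → ℝ}
    (hrev : GlobalMeanReversion P ℱ T μ M) (hM : BoundedPrices P ℱ T M) (hT : 2 ≤ T) {δ : ℝ}
    (hδ : 0 < δ) (hδ1 : δ ≤ 1) :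
    P.real (meanFailure T (globalRadius T δ) M μ) ≤ δ := by
  have hT' : (2 : ℝ) ≤ T := by exact_mod_cast hT
  have hL0 : 0 ≤ Real.log (2 * T / δ) := Real.log_nonneg ((one_le_div hδ).2 (by linarith))
  refine _root_.measure_meanFailure_le hδ (by omega) fun t ht => ?_
  have ht0 : (0 : ℝ) < t := by exact_mod_cast ht.1
  refine (GlobalMeanReversion.measure_abs_ge_le hM.adapted hM.mem_Icc hrev
    (hrev.mean_mem_Icc hM hT) ht.1 ht.2 (mul_nonneg ht0.le (Real.sqrt_nonneg _))).trans ?_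
  -- The exponent is twice what the union bound requires.
  have : -(t * √(4 * Real.log (2 * T / δ) / t)) ^ 2 / (2 * t) = -(2 * Real.log (2 * T / δ)) := by
    rw [mul_pow, Real.sq_sqrt (by positivity)]
    field_simp
    ring
  rw [this]
  gcongr
  linarith

/-! ### Local mean reversion -/

section Local

variable {ℱ : Filtration ℕ mΩ} {k : ℕ} {g : Fin k → ℝ} {μ : ℝ} {η : ℕ → Ω → ℝ} {M : ℤ → Ω → ℝ}

theorem LocalMeanReversion.stronglyMeasurable (h : LocalMeanReversion P ℱ T k g μ η M)
    (hM : BoundedPrices P ℱ T (fun t : ℕ => M t)) {t : ℕ} (ht : t ≤ T) {j : ℤ}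
    (hj : -(k : ℤ) < j) (hjt : j ≤ t) : StronglyMeasurable[ℱ t] (M j) := by
  rcases le_or_gt j 0 with h0 | h0
  · exact (h.initial_measurable j hj h0).mono (ℱ.mono (Nat.zero_le t))
  · lift j to ℕ using h0.le
    exact (hM.adapted j ⟨by omega, by omega⟩).mono (ℱ.mono (by omega))

theorem LocalMeanReversion.mem_Icc (h : LocalMeanReversion P ℱ T k g μ η M)
    (hM : BoundedPrices P ℱ T (fun t : ℕ => M t)) {j : ℤ}
    (hj : -(k : ℤ) < j) (hjT : j ≤ T) : ∀ᵐ ω ∂P, M j ω ∈ Set.Icc (0 : ℝ) 1 := by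
  rcases le_or_gt j 0 with h0 | h0
  · exact h.initial_mem_Icc j hj h0
  · lift j to ℕ using h0.le
    exact hM.mem_Icc j ⟨by omega, by omega⟩

theorem LocalMeanReversion.recoveredNoise_ae_eq (h : LocalMeanReversion P ℱ T k g μ η M) {t : ℕ}
    (ht : t < T) : recoveredNoise g M (t + 1) =ᵐ[P] η (t + 1) := by
  filter_upwards [h.recursion t ht] with ω hω
  have h1 := h.weight_sum_lt_one
  rw [recoveredNoise, div_eq_iff (by linarith)]
  push_cast
  rw [hω]
  simp only [add_sub_cancel_right]
  ring

theorem LocalMeanReversion.recoveredNoise_mem_Icc (h : LocalMeanReversion P ℱ T k g μ η M) :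
    ∀ s ∈ Set.Icc 1 T, ∀ᵐ ω ∂P, recoveredNoise g M s ω ∈ Set.Icc (0 : ℝ) 1 := by
  rintro s ⟨hs1, hsT⟩
  obtain ⟨t, rfl⟩ : ∃ t, s = t + 1 := ⟨s - 1, by omega⟩
  filter_upwards [h.recoveredNoise_ae_eq (t := t) (by omega), h.noise_mem_Icc t (by omega)]
    with ω h1 h2
  rwa [h1]

/-- This is why the noise is solved for from the prices: `η` itself is not assumed adapted. -/
theorem LocalMeanReversion.recoveredNoise_adapted (h : LocalMeanReversion P ℱ T k g μ η M)
    (hM : BoundedPrices P ℱ T (fun t : ℕ => M t)) :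
    ∀ s ∈ Set.Icc 1 T, StronglyMeasurable[ℱ s] (recoveredNoise g M s) := by
  rintro s ⟨hs1, hsT⟩
  unfold recoveredNoise
  simp only [div_eq_mul_inv]
  refine StronglyMeasurable.mul_const (StronglyMeasurable.sub
    (h.stronglyMeasurable hM hsT (by omega) le_rfl)
    (Finset.stronglyMeasurable_fun_sum _ fun τ _ =>
      (h.stronglyMeasurable hM hsT ?_ ?_).const_mul _)) _
  · have := τ.2; omega
  · omega

theorem LocalMeanReversion.condExp_recoveredNoise (h : LocalMeanReversion P ℱ T k g μ η M) :
    ∀ t < T, P[recoveredNoise g M (t + 1) | ℱ t] =ᵐ[P] fun _ => μ := fun t ht =>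
  (condExp_congr_ae (h.recoveredNoise_ae_eq ht)).trans (h.noise_mean t ht)

theorem LocalMeanReversion.mean_mem_Icc [IsProbabilityMeasure P] (h : LocalMeanReversion P ℱ T k g μ η M)
    (hM : BoundedPrices P ℱ T (fun t : ℕ => M t)) (hT : 1 ≤ T) : μ ∈ Set.Icc (0 : ℝ) 1 := by
  have h1 : 0 + 1 ∈ Set.Icc 1 T := ⟨le_rfl, hT⟩
  have h01 := h.recoveredNoise_mem_Icc (0 + 1) h1
  have hint : ∫ ω, recoveredNoise g M (0 + 1) ω ∂P = μ := by
    rw [← integral_condExp (ℱ.le 0), integral_congr_ae (h.condExp_recoveredNoise 0 hT)]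
    simp
  have hi : Integrable (recoveredNoise g M (0 + 1)) P := by
    refine Integrable.of_bound
      ((h.recoveredNoise_adapted hM _ h1).mono (ℱ.le _)).aestronglyMeasurable 1 ?_
    filter_upwards [h01] with ω hω
    rw [Real.norm_eq_abs, abs_of_nonneg hω.1]
    exact hω.2
  rw [← hint]
  constructor
  · exact integral_nonneg_of_ae (h01.mono fun ω hω => hω.1)
  · refine (integral_mono_ae hi (integrable_const 1) (h01.mono fun ω hω => hω.2)).trans ?_
    simp

theorem LocalMeanReversion.measure_meanFailure_le [IsProbabilityMeasure P] (h : LocalMeanReversion P ℱ T k g μ η M)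
    (hM : BoundedPrices P ℱ T (fun t : ℕ => M t)) (hT : 1 ≤ T) {δ : ℝ}
    (hδ : 0 < δ) (hδ1 : δ ≤ 1) :
    P.real (meanFailure T (fun t => √(Real.log (2 * T / δ) / (2 * t)))
      (recoveredNoise g M) μ) ≤ δ := by
  have hT' : (1 : ℝ) ≤ T := by exact_mod_cast hT
  have hL0 : 0 ≤ Real.log (2 * T / δ) := Real.log_nonneg ((one_le_div hδ).2 (by linarith))
  refine _root_.measure_meanFailure_le hδ hT fun t ht => ?_
  have ht0 : (0 : ℝ) < t := by exact_mod_cast ht.1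
  refine ((hasSubgaussianMGF_sum_of_condExp (h.recoveredNoise_adapted hM)
    h.recoveredNoise_mem_Icc h.condExp_recoveredNoise (h.mean_mem_Icc hM hT) t
    ht.2).measure_abs_ge_le (mul_nonneg ht0.le (Real.sqrt_nonneg _))).trans (le_of_eq ?_)
  congr 2
  rw [mul_pow, Real.sq_sqrt (by positivity)]
  push_cast
  field_simp
  ring

end Local

end Confidence

/-! ### Regret of LazyOPSR -/

section Main

variable {Ω : Type u} [mΩ : MeasurableSpace Ω] {P : Measure Ω} [IsProbabilityMeasure P]
  {ν : Measure ℝ} [IsProbabilityMeasure ν] {ℱ : Filtration ℕ mΩ} {T : ℕ} {δ μ : ℝ}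
  {V : ℕ → Ω → ℝ}

theorem measure_lt_lazyRegret_eq_zero {P : Measure Ω} {M : ℕ → Ω → ℝ} (hM : BoundedPrices P ℱ T M) (hT : 1 ≤ T)
    (hT64 : T ≤ 64) {δ' X : ℝ} {φ : ℕ → ℝ} (hX : 32 * √T ≤ X) :
    P {ω | X < lazyRegret ν T δ' φ (fun t => V t ω) (fun t => M t ω)} = 0 := by
  refine measure_mono_null_ae ?_ (measure_empty (μ := P))
  filter_upwards [(ae_ball_iff (Set.to_countable (Set.Icc 1 T))).2 hM.mem_Icc] with ω hω hlt
  have h1 := lazyRegret_le_trivial (ν := ν) (δ := δ') (φ := φ) (v := fun t => V t ω) hT hω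
  have h2 := four_mul_le_of_lt hT64
  exact absurd hlt (not_lt.2 (h1.trans (h2.trans hX)))

theorem LocalMeanReversion.measure_lt_lazyRegret_le {k : ℕ} {g : Fin k → ℝ} {η : ℕ → Ω → ℝ}
    {M : ℤ → Ω → ℝ} (hT : 1 ≤ T) (hδ : 0 < δ) (hδ1 : δ < 1) (hV : StochasticValuations P ν T V)
    (hM : BoundedPrices P ℱ T (fun t : ℕ => M t)) (h : LocalMeanReversion P ℱ T k g μ η M) :
    P {ω | √(2007 * T * Real.log (6 * T / δ)) +
          8 * (∑ τ, g τ) * (k + 1) * Real.log T / (1 - ∑ τ, g τ) + 32 * √T <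
        lazyRegret ν T (δ / 2) (localRadius T (δ / 2) (∑ τ, g τ) k)
          (fun t => V t ω) (fun t => M t ω)} ≤ ENNReal.ofReal δ := by
  have hγ : 0 ≤ ∑ τ, g τ := Finset.sum_nonneg fun τ _ => h.weight_nonneg τ
  have hγ1 := h.weight_sum_lt_one
  rcases le_or_gt T 64 with hT64 | hT64
  · refine (measure_lt_lazyRegret_eq_zero hM hT hT64 ?_).trans_le zero_le
    have : 0 ≤ 8 * (∑ τ, g τ) * (k + 1) * Real.log T / (1 - ∑ τ, g τ) :=
      div_nonneg (mul_nonneg (by positivity) (Real.log_natCast_nonneg T)) (by linarith)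
    linarith [Real.sqrt_nonneg (2007 * T * Real.log (6 * T / δ))]
  · refine measure_le_of_ae_mem_union ?_
      (hV.measure_cdfFailure_le hT (half_pos hδ) (by linarith))
      (h.measure_meanFailure_le hM hT (half_pos hδ) (by linarith))
    filter_upwards [(ae_ball_iff (Set.to_countable (Set.Ioc (-(k : ℤ)) T))).2
      fun j hj => h.mem_Icc hM hj.1 hj.2] with ω hω hcdf hmean hlt
    refine absurd hlt (not_lt.2 (GoodPath.lazyRegret_local_le hT64 hδ hδ1 hγ hγ1
      (goodPath_of_notMem_cdfFailure (h.mean_mem_Icc hM hT) hcdf fun t ht1 ht => ?_)))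
    exact mean_close_of_notMem_meanFailure h.weight_nonneg hγ1 (fun j h1 h2 => hω j ⟨h1, h2⟩)
      hmean ht1 ht

theorem GlobalMeanReversion.measure_lt_lazyRegret_le {M : ℕ → Ω → ℝ} (hT : 1 ≤ T) (hδ : 0 < δ)
    (hδ1 : δ < 1) (hV : StochasticValuations P ν T V) (hM : BoundedPrices P ℱ T M)
    (h : GlobalMeanReversion P ℱ T μ M) :
    P {ω | √(20783 * T * Real.log (6 * T / δ)) + 32 * √T <
        lazyRegret ν T (δ / 2) (globalRadius T (δ / 2))
          (fun t => V t ω) (fun t => M t ω)} ≤ ENNReal.ofReal δ := by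
  -- The short-horizon case also absorbs `T = 1`, where `μ` need not lie in `[0,1]`.
  rcases le_or_gt T 64 with hT64 | hT64
  · refine (measure_lt_lazyRegret_eq_zero hM hT hT64 ?_).trans_le zero_le
    linarith [Real.sqrt_nonneg (20783 * T * Real.log (6 * T / δ))]
  · refine measure_le_of_ae_mem_union (Filter.Eventually.of_forall fun ω hcdf hmean hlt => ?_)
      (hV.measure_cdfFailure_le hT (half_pos hδ) (by linarith))
      (h.measure_meanFailure_le hM (by omega) (half_pos hδ) (by linarith))
    exact absurd hlt (not_lt.2 (GoodPath.lazyRegret_global_le hT hδ hδ1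
      (goodPath_of_notMem_cdfFailure (h.mean_mem_Icc hM (by omega)) hcdf fun t ht1 ht =>
        abs_sum_div_sub_le ht1 (lt_of_notMem_meanFailure hmean ht1 ht).le)))

end Main

end

theorem mainTheorem2 :
    ∃ C : ℝ,
      (∀ (Ω : Type u) [mΩ : MeasurableSpace Ω] (P : Measure Ω) [IsProbabilityMeasure P]
        (ν : Measure ℝ) [IsProbabilityMeasure ν] (ℱ : Filtration ℕ mΩ)
        (T : ℕ) (_ : 1 ≤ T) (δ : ℝ) (_ : 0 < δ) (_ : δ < 1)
        (k : ℕ) (g : Fin k → ℝ) (γ : ℝ) (_ : γ = ∑ τ, g τ) (μ : ℝ)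
        (V : ℕ → Ω → ℝ) (η : ℕ → Ω → ℝ) (M : ℤ → Ω → ℝ),
        StochasticValuations P ν T V →
        BoundedPrices P ℱ T (fun t : ℕ => M t) →
        LocalMeanReversion P ℱ T k g μ η M →
        P {ω |
            √(2007 * T * Real.log (6 * T / δ)) + 8 * γ * (k + 1) * Real.log T / (1 - γ)
              + C * √T <
            lazyRegret ν T (δ / 2) (localRadius T (δ / 2) γ k)
              (fun t => V t ω) (fun t => M t ω)} ≤ ENNReal.ofReal δ) ∧
      (∀ (Ω : Type u) [mΩ : MeasurableSpace Ω] (P : Measure Ω) [IsProbabilityMeasure P]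
        (ν : Measure ℝ) [IsProbabilityMeasure ν] (ℱ : Filtration ℕ mΩ)
        (T : ℕ) (_ : 1 ≤ T) (δ : ℝ) (_ : 0 < δ) (_ : δ < 1) (μ : ℝ)
        (V : ℕ → Ω → ℝ) (M : ℕ → Ω → ℝ),
        StochasticValuations P ν T V →
        BoundedPrices P ℱ T M →
        GlobalMeanReversion P ℱ T μ M →
        P {ω |
            √(20783 * T * Real.log (6 * T / δ)) + C * √T <
            lazyRegret ν T (δ / 2) (globalRadius T (δ / 2))
              (fun t => V t ω) (fun t => M t ω)} ≤ ENNReal.ofReal δ) := by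
  -- `32 * √T` dominates the trivial bound `4 * T` when `T ≤ 64`; longer horizons need only `4 *
  -- √T`.
  refine ⟨32, ?_, ?_⟩
  · intro Ω _ P _ ν _ ℱ T hT δ hδ hδ1 k g γ hγ μ V η M hV hM h
    subst hγ
    exact h.measure_lt_lazyRegret_le hT hδ hδ1 hV hM
  · intro Ω _ P _ ν _ ℱ T hT δ hδ hδ1 μ V M hV hM h
    exact h.measure_lt_lazyRegret_le hT hδ hδ1 hV hM
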